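/- **Setting.** Let $p:\mathbb R\to[0,\infty)$ be a (measurable) probability density with $p_0:=p(0)>0$ which is twice continuously differentiable on some interval $(0,x_0)$, $x_0>0$, and for which the limits $p_1:=p'(0+)$ and $p_2:=p''(0+)$ exist and are finite. Let $\theta\in\mathbb R$ and let $X_1,X_2,\dots$ be independent real random variables with common density $p(\cdot-\theta)$. With $X_{(1)}\le\dots\le X_{(m)}$ the order statistics of $X_1,\dots,X_m$, the sample median is $M_m=X_{(j)}$ if $m=2j-1$ and $M_m=(X_{(j)}+X_{(j+1)})/2$ if $m=2j$. Put $m^*=2[m/2]$, where $[\cdot]$ is the integer part. Let $\Phi$ and $\varphi$ be the standard normal distribution function and density, and put $$f_1(x)=\frac{p_1x|x|}{4p_0^2}\,\varphi(x),\qquad f_2(x)=\frac x4\Big(3+x^2+\frac{p_2x^2}{6p_0^3}-\frac{p_1^2x^4}{8p_0^4}\Big)\varphi(x).$$ For $s>0$ let $Y_1,Y_2,\dots$ be independent discrete Pareto II$(s)$ variables, i.e. $\mathbb P(Y_j=k)=\frac{s}{s+k-1}-\frac{s}{s+k}$ for $k=1,2,\dots$, and let $N_n=\max_{1\le j\le n}Y_j$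 for $n\ge1$. Assume that for every $n\ge 1$ the variable $N_n$ is independent of the sequence $(X_i)_{i\ge1}$, and write $N_n^*=2[N_n/2]$. For $\mu>0$ let $L_\mu$ be the distribution function of the Laplace distribution with density $l_\mu(x)=\frac1{\sqrt2\,\mu}e^{-\sqrt2|x|/\mu}$, so that $l_{1/\sqrt s}(x)=\sqrt{s/2}\,e^{-\sqrt{2s}\,|x|}$. **Theorem.** Let $s>0$. Suppose that, for a constant $C_2$, the sample median of a nonrandom number of observations satisfies, for all $m\ge1$, $$\sup_{x\in\mathbb R}\Big|\mathbb P\big(2p_0\sqrt{m^*}\,(M_m-\theta)\le x\big)-\Phi(x)-\frac{f_1(x)}{\sqrt m}-\frac{f_2(x)}{m}\Big|\le\frac{C_2}{m^{3/2}}.$$ Then there is a constant $C_s$, depending only on $s$, $p$ and $C_2$ (in particular not on $n$, $x$ or $\theta$), such that for all $n\ge1$ $$\sup_{x\in\mathbb R}\Big|\mathbb P\Big(2p_0\sqrt{nN_n^*/N_n}\,(M_{N_n}-\theta)\le x\Big)-L_{1/\sqrt s}(x;n)\Big|\le C_s\,n^{-3/2},$$ where $$L_{1/\sqrt s}(x;n)=L_{1/\sqrt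 s}(x)+l_{1/\sqrt s}(x)\big(A_{1;s}(x)\,n^{-1/2}+A_{2;s}(x)\,n^{-1}\big),\qquad A_{1;s}(x)=\frac{p_1x|x|}{4p_0^2},$$ $$A_{2;s}(x)=\frac{(4-s)\,x\,(1+\sqrt{2s}\,|x|)}{8s}+\frac{x^3}{4}\Big(1+\frac{p_2}{6p_0^3}\Big)-\frac{p_1^2\,x^3|x|\sqrt{2s}}{32\,p_0^4}.$$ -/

import Mathlib

open MeasureTheory ProbabilityTheory Filter Set
open scoped Topology

namespace RandomMedian

noncomputable section

/-! ### Sample median -/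

/-- The `k`-th order statistic `X_(k)` (`1 ≤ k ≤ m`) of the sample consisting of the first `m`
terms of the sequence `x` (the observation `X_i` is `x (i - 1)`), i.e. the `k`-th entry of the
sample rearranged in nondecreasing order. The value is `0` if `k` is out of range. -/
def orderStat (x : ℕ → ℝ) (m k : ℕ) : ℝ :=
  if h : 1 ≤ k ∧ k ≤ m then
    (fun i : Fin m => x i) (Tuple.sort (fun i : Fin m => x i) ⟨k - 1, by omega⟩)
  else 0

/-- The sample median `M_m`: it is `X_(j)` for `m = 2j - 1` and `(X_(j) + X_(j+1)) / 2`
for `m = 2j`. -/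
def sampleMedian (x : ℕ → ℝ) (m : ℕ) : ℝ :=
  if Odd m then orderStat x m ((m + 1) / 2)
  else (orderStat x m (m / 2) + orderStat x m (m / 2 + 1)) / 2

/-- `m* = 2 [m / 2]`. -/
def evenPart (m : ℕ) : ℕ := 2 * (m / 2)

/-! ### Normal and Laplace distributions, expansion terms -/

/-- The standard normal density `φ`. -/
def stdNormalDensity (x : ℝ) : ℝ := Real.exp (-x ^ 2 / 2) / √(2 * Real.pi)

/-- The standard normal distribution function `Φ`. -/
def stdNormalCdf (x : ℝ) : ℝ := ∫ u in Iic x, stdNormalDensity u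

/-- The density `l_μ` of the symmetric Laplace distribution. -/
def laplaceDensity (μ x : ℝ) : ℝ := 1 / (√2 * μ) * Real.exp (-(√2 * |x|) / μ)

/-- The distribution function `L_μ` of the symmetric Laplace distribution. -/
def laplaceCdf (μ x : ℝ) : ℝ := ∫ u in Iic x, laplaceDensity μ u

/-- The coefficient `f₁` of the second order expansion of the sample median. -/
def f₁ (p₀ p₁ x : ℝ) : ℝ := p₁ * x * |x| / (4 * p₀ ^ 2) * stdNormalDensity x

/-- The coefficient `f₂` of the second order expansion of the sample median. -/
def f₂ (p₀ p₁ p₂ x : ℝ) : ℝ :=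
  x / 4 * (3 + x ^ 2 + p₂ * x ^ 2 / (6 * p₀ ^ 3) - p₁ ^ 2 * x ^ 4 / (8 * p₀ ^ 4))
    * stdNormalDensity x

/-- The coefficient `A_{1;s}`. -/
def A₁ (p₀ p₁ x : ℝ) : ℝ := p₁ * x * |x| / (4 * p₀ ^ 2)

/-- The coefficient `A_{2;s}`. -/
def A₂ (s p₀ p₁ p₂ x : ℝ) : ℝ :=
  (4 - s) * x * (1 + √(2 * s) * |x|) / (8 * s)
    + x ^ 3 / 4 * (1 + p₂ / (6 * p₀ ^ 3))
    - p₁ ^ 2 * x ^ 3 * |x| * √(2 * s) / (32 * p₀ ^ 4)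

/-- The approximating function `L_{1/√s}(x; n)`. -/
def laplaceExpansion (s p₀ p₁ p₂ : ℝ) (n : ℕ) (x : ℝ) : ℝ :=
  laplaceCdf (1 / √s) x + laplaceDensity (1 / √s) x *
    (A₁ p₀ p₁ x * (n : ℝ) ^ (-(1 / 2) : ℝ) + A₂ s p₀ p₁ p₂ x * (n : ℝ) ^ (-1 : ℝ))

/-! ### The probabilistic model -/

variable {Ω : Type*} [MeasurableSpace Ω]

/-- `X` is a sequence of independent random variables with common density `p (· - θ)`. -/
structure IsLocationSample (p : ℝ → ℝ) (θ : ℝ) (X : ℕ → Ω → ℝ) (P : Measure Ω) : Prop where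
  indep : iIndepFun X P
  law : ∀ i, HasLaw (X i) (volume.withDensity fun x => ENNReal.ofReal (p (x - θ))) P

/-- `Y` is a sequence of independent discrete Pareto II random variables with parameter `s`.
The masses of the points `1, 2, …` sum up to one, so that `0` has probability zero. -/
structure IsDiscreteParetoSample (s : ℝ) (Y : ℕ → Ω → ℕ) (P : Measure Ω) : Prop where
  aemeasurable : ∀ j, AEMeasurable (Y j) P
  indep : iIndepFun Y P
  pmf : ∀ j, ∀ k : ℕ, 1 ≤ k → P.real {ω | Y j ω = k} = s / (s + k - 1) - s / (s + k)

/-- The random sample size `N_n`, the maximum of the first `n ≥ 1` terms of the sequence `Y`. -/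
def sampleSize (Y : ℕ → Ω → ℕ) (n : ℕ) (ω : Ω) : ℕ := (Finset.range n).sup fun j => Y j ω

/-- Second order expansion of the distribution of the sample median `M_m` of a nonrandom number
of observations, with remainder at most `C₂ m^{-3/2}` for every `m ≥ 1`, uniformly in `x`. -/
def MedianExpansion (p₀ p₁ p₂ C₂ θ : ℝ) (X : ℕ → Ω → ℝ) (P : Measure Ω) : Prop :=
  ∀ m : ℕ, 1 ≤ m → ∀ x : ℝ,
    |P.real {ω | 2 * p₀ * √(evenPart m : ℝ) * (sampleMedian (fun i => X i ω) m - θ) ≤ x}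
        - stdNormalCdf x - f₁ p₀ p₁ x / √(m : ℝ) - f₂ p₀ p₁ p₂ x / m|
      ≤ C₂ / (m : ℝ) ^ (3 / 2 : ℝ)

/-- The normalized median `2 p₀ √(n N_n* / N_n) (M_{N_n} - θ)` of the sample of random
size `N = N_n`, at an outcome `ω`. -/
def normalizedMedian (p₀ θ : ℝ) (X : ℕ → Ω → ℝ) (n : ℕ) (N : Ω → ℕ) (ω : Ω) : ℝ :=
  2 * p₀ * √((n : ℝ) * (evenPart (N ω) : ℝ) / (N ω : ℝ))
    * (sampleMedian (fun i => X i ω) (N ω) - θ)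

end

end RandomMedian

open RandomMedian

namespace RandomMedian

/-! ### Calculus on the half line -/

/-! Conditioning on the sample size turns the distribution function of the normalized median into
the mean, over m = N_n, of its value for fixed m. There the assumed expansion applies at the point
x√(m/n), and its remainder m^(-3/2) averages to O(n^(-3/2))
(`exists_abs_integral_fixedSizeCdf_sub_le`). What remains is to average explicit functions of u =
N_n/n.

The mass function telescopes, so P(N_n ≤ m) = (m/(s+m))^n. Hence N_n has the law of ⌈V⌉ with V =
s/(exp(T/n) - 1) and T standard exponential (`map_sampleSize_eq`). Expanding the exponential gives
N_n/n = s/T + (ρ + (1-s)/2)/n + O(T/n²), where ρ is the centred rounding error. The terms from `f₁`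
and `f₂` already carry n^(-1/2) or n^(-1), so replacing N_n/n by s/T costs them only a further 1/n.
The leading term Φ(x√u) needs a second order Taylor expansion. The shift (1-s)/2 contributes to
`A₂`, while the mean of the oscillating ρ against a smooth weight is itself O(1/n) by integration by
parts (`exists_abs_integral_roundingError_le`).

The limiting averages over s/T are integrals of t^(k-1/2) exp(-t - c²/t) with 2c = √(2s)|x|. They
are elementary and produce the Laplace density, and integrating Φ(x√(s/t)) by parts produces the
Laplace distribution function. Uniformity in x comes from the boundedness of z^k φ(z). -/

/-- Fundamental theorem of calculus on `(0, ∞)` with one-sided limits at both ends and a countable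
exceptional set. -/
theorem integral_Ioi_zero_of_hasDerivAt_off_countable {f f' : ℝ → ℝ} {a b : ℝ} {S : Set ℝ}
    (hS : S.Countable) (hcont : ContinuousOn f (Ioi 0))
    (hderiv : ∀ t ∈ Ioi (0 : ℝ) \ S, HasDerivAt f (f' t) t)
    (hint : IntegrableOn f' (Ioi 0)) (h0 : Tendsto f (𝓝[>] 0) (𝓝 a))
    (htop : Tendsto f atTop (𝓝 b)) : ∫ t in Ioi 0, f' t = b - a := by
  classical
  -- Giving `f` its limit as value at 0 makes it continuous on closed intervals [0, x], as the
  -- interval version of the theorem requires.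
  set F : ℝ → ℝ := Function.update f 0 a with hF
  have hFf : ∀ t, 0 < t → F t = f t := fun t ht => Function.update_of_ne ht.ne' _ _
  have hF0 : F 0 = a := Function.update_self _ _ _
  have hFc : ContinuousOn F (Ici 0) := by
    intro t ht
    rcases (show (0 : ℝ) ≤ t from ht).eq_or_lt with rfl | ht
    · exact continuousWithinAt_update_same.2 (by simpa using h0)
    · have h1 : ContinuousAt f t := hcont.continuousAt (Ioi_mem_nhds ht)
      exact (h1.congr (by
        filter_upwards [Ioi_mem_nhds ht] with u hu using (hFf u hu).symm)).continuousWithinAt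
  refine tendsto_nhds_unique (intervalIntegral_tendsto_integral_Ioi 0 hint tendsto_id) ?_
  refine (htop.sub_const a).congr' ?_
  filter_upwards [Ioi_mem_atTop (0 : ℝ)] with x hx
  have hx : (0 : ℝ) < x := hx
  rw [id, integral_eq_of_hasDerivAt_off_countable_of_le F f' hx.le hS
    (hFc.mono Icc_subset_Ici_self) ?_ ?_, hF0, hFf x hx]
  · intro t ht
    refine (hderiv t ⟨ht.1.1, ht.2⟩).congr_of_eventuallyEq ?_
    filter_upwards [Ioi_mem_nhds ht.1.1] with u hu using hFf u hu
  · rw [intervalIntegrable_iff_integrableOn_Ioc_of_le hx.le]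
    exact hint.mono_set Ioc_subset_Ioi_self

theorem integral_Ioi_zero_of_hasDerivAt {f f' : ℝ → ℝ} {a b : ℝ}
    (hderiv : ∀ t ∈ Ioi (0 : ℝ), HasDerivAt f (f' t) t)
    (hint : IntegrableOn f' (Ioi 0)) (h0 : Tendsto f (𝓝[>] 0) (𝓝 a))
    (htop : Tendsto f atTop (𝓝 b)) : ∫ t in Ioi 0, f' t = b - a :=
  integral_Ioi_zero_of_hasDerivAt_off_countable countable_empty
    (fun t ht => (hderiv t ht).continuousAt.continuousWithinAt)
    (fun t ht => hderiv t ht.1) hint h0 htop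

theorem integrableOn_of_abs_le {f g : ℝ → ℝ} {S : Set ℝ} (hS : MeasurableSet S)
    (hg : IntegrableOn g S) (hf : AEStronglyMeasurable f (volume.restrict S))
    (h : ∀ t ∈ S, |f t| ≤ g t) : IntegrableOn f S :=
  Integrable.mono' hg hf ((ae_restrict_iff' hS).2 (Eventually.of_forall h))

theorem integrableOn_pow_mul_exp_neg (k : ℕ) {b : ℝ} (hb : 0 < b) :
    IntegrableOn (fun t : ℝ => t ^ k * Real.exp (-(b * t))) (Ioi 0) := by
  have h := integrableOn_rpow_mul_exp_neg_mul_rpow (s := k) (p := 1) (b := b)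
    (by have : (0 : ℝ) ≤ k := k.cast_nonneg
        linarith) one_pos hb
  refine h.congr_fun (fun t _ => ?_) measurableSet_Ioi
  simp [Real.rpow_natCast]

theorem integrableOn_exp_neg : IntegrableOn (fun t : ℝ => Real.exp (-t)) (Ioi 0) := by
  simpa using integrableOn_pow_mul_exp_neg 0 one_pos

/-! ### The standard normal distribution -/

theorem stdNormalDensity_nonneg (x : ℝ) : 0 ≤ stdNormalDensity x := by
  unfold stdNormalDensity; positivity

theorem continuous_stdNormalDensity : Continuous stdNormalDensity := by
  unfold stdNormalDensity; fun_prop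

theorem integrable_stdNormalDensity : Integrable stdNormalDensity := by
  have h := (integrable_exp_neg_mul_sq (b := 1 / 2) (by norm_num)).div_const √(2 * Real.pi)
  refine h.congr (Eventually.of_forall fun x => ?_)
  simp only [stdNormalDensity]; ring_nf

theorem integral_stdNormalDensity : ∫ x, stdNormalDensity x = 1 := by
  have h := integral_gaussian (1 / 2)
  have h2 : √(Real.pi / (1 / 2)) = √(2 * Real.pi) := by congr 1; ring
  rw [h2] at h
  have h3 : ∫ x, stdNormalDensity x
      = (∫ x : ℝ, Real.exp (-(1 / 2) * x ^ 2)) / √(2 * Real.pi) := by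
    rw [← integral_div]
    congr 1; ext x; simp only [stdNormalDensity]; ring_nf
  rw [h3, h, div_self (by positivity)]

theorem hasDerivAt_stdNormalCdf (x : ℝ) :
    HasDerivAt stdNormalCdf (stdNormalDensity x) x := by
  have h : stdNormalCdf = fun y => (∫ u in (0 : ℝ)..y, stdNormalDensity u) + stdNormalCdf 0 := by
    ext y
    have := intervalIntegral.integral_Iic_sub_Iic (μ := volume) (f := stdNormalDensity)
      (a := 0) (b := y) integrable_stdNormalDensity.integrableOn
      integrable_stdNormalDensity.integrableOn
    simp only [stdNormalCdf]; linarith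
  rw [h]
  exact (intervalIntegral.integral_hasDerivAt_right
    (continuous_stdNormalDensity.intervalIntegrable _ _)
    (continuous_stdNormalDensity.stronglyMeasurableAtFilter _ _)
    continuous_stdNormalDensity.continuousAt).add_const _

theorem continuous_stdNormalCdf : Continuous stdNormalCdf :=
  continuous_iff_continuousAt.2 fun x => (hasDerivAt_stdNormalCdf x).continuousAt

theorem stdNormalCdf_neg (x : ℝ) : stdNormalCdf (-x) = 1 - stdNormalCdf x := by
  have h1 : stdNormalCdf (-x) = ∫ u in Ioi x, stdNormalDensity u := by
    have h := integral_comp_neg_Ioi x stdNormalDensity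
    rw [stdNormalCdf, ← h]
    congr 1; ext u; simp [stdNormalDensity]
  have h2 := intervalIntegral.integral_Iic_add_Ioi (μ := volume) (f := stdNormalDensity) (b := x)
    integrable_stdNormalDensity.integrableOn integrable_stdNormalDensity.integrableOn
  rw [integral_stdNormalDensity] at h2
  rw [h1]; simp only [stdNormalCdf]; linarith

theorem stdNormalCdf_zero : stdNormalCdf 0 = 1 / 2 := by
  have := stdNormalCdf_neg 0
  rw [neg_zero] at this; linarith

theorem stdNormalCdf_nonneg (x : ℝ) : 0 ≤ stdNormalCdf x :=
  integral_nonneg fun _ => stdNormalDensity_nonneg _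

theorem stdNormalCdf_le_one (x : ℝ) : stdNormalCdf x ≤ 1 := by
  have := stdNormalCdf_nonneg (-x)
  rw [stdNormalCdf_neg] at this; linarith

theorem abs_stdNormalCdf_le (x : ℝ) : |stdNormalCdf x| ≤ 1 := by
  rw [abs_of_nonneg (stdNormalCdf_nonneg x)]; exact stdNormalCdf_le_one x

theorem tendsto_stdNormalCdf_atTop : Tendsto stdNormalCdf atTop (𝓝 1) := by
  have h := (aecover_Iic (μ := volume) (tendsto_id (α := ℝ) (x := atTop))).integral_tendsto_of_countably_generated
    integrable_stdNormalDensity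
  rw [integral_stdNormalDensity] at h
  exact h

theorem tendsto_stdNormalCdf_atBot : Tendsto stdNormalCdf atBot (𝓝 0) := by
  have h := (tendsto_stdNormalCdf_atTop.comp tendsto_neg_atBot_atTop).const_sub 1
  rw [sub_self] at h
  refine h.congr fun x => ?_
  simp [stdNormalCdf_neg]

theorem hasDerivAt_stdNormalDensity (x : ℝ) :
    HasDerivAt stdNormalDensity (-x * stdNormalDensity x) x := by
  have h1 : HasDerivAt (fun y : ℝ => -y ^ 2 / 2) (-x) x := by
    have := ((hasDerivAt_pow 2 x).neg).div_const 2
    refine this.congr_deriv ?_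
    norm_num
    ring
  have h2 := (h1.exp).div_const √(2 * Real.pi)
  refine h2.congr_deriv ?_
  simp only [stdNormalDensity]; ring

/-- The exponential series bounds z^(2k) by a multiple of exp(z²/2), and |z|^k ≤ 1 + z^(2k) reduces
odd powers to even ones. Every later constant is uniform in x because of this bound. -/
theorem exists_pow_mul_stdNormalDensity_le (k : ℕ) :
    ∃ K : ℝ, 0 ≤ K ∧ ∀ z : ℝ, |z ^ k * stdNormalDensity z| ≤ K := by
  refine ⟨(1 + 2 ^ k * (Nat.factorial k : ℝ)) / √(2 * Real.pi), by positivity, fun z => ?_⟩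
  have h1 : |z| ^ k ≤ 1 + z ^ (2 * k) := by
    rw [pow_mul, ← sq_abs, ← pow_mul, mul_comm, pow_mul]
    nlinarith [sq_nonneg (|z| ^ k - 1)]
  have h2 : (z ^ 2 / 2) ^ k / (Nat.factorial k : ℝ) ≤ Real.exp (z ^ 2 / 2) :=
    Real.pow_div_factorial_le_exp _ (by positivity) k
  have hf : (0 : ℝ) < Nat.factorial k := by exact_mod_cast Nat.factorial_pos k
  have h3 : z ^ (2 * k) ≤ 2 ^ k * (Nat.factorial k : ℝ) * Real.exp (z ^ 2 / 2) := by
    rw [div_le_iff₀ hf, div_pow, div_le_iff₀ (by positivity), ← pow_mul] at h2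
    linarith
  have h4 : 1 ≤ Real.exp (z ^ 2 / 2) := Real.one_le_exp (by positivity)
  rw [abs_mul, abs_of_nonneg (stdNormalDensity_nonneg z), abs_pow, stdNormalDensity, ← mul_div_assoc]
  gcongr
  rw [neg_div, Real.exp_neg, mul_inv_le_iff₀ (Real.exp_pos _)]
  linarith

/-! ### Gaussian monomials along `u ↦ x √u` -/

/-- The function `u ↦ z ^ k φ(z)` with `z = x √u`. -/
noncomputable def gaussMonomial (k : ℕ) (x u : ℝ) : ℝ := (x * √u) ^ k * stdNormalDensity (x * √u)

theorem exists_gaussMonomial_le (k : ℕ) :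
    ∃ K : ℝ, 0 ≤ K ∧ ∀ x u : ℝ, |gaussMonomial k x u| ≤ K := by
  obtain ⟨K, hK, h⟩ := exists_pow_mul_stdNormalDensity_le k
  exact ⟨K, hK, fun x u => h _⟩

theorem continuous_gaussMonomial (k : ℕ) (x : ℝ) : Continuous (gaussMonomial k x) := by
  have := continuous_stdNormalDensity
  unfold gaussMonomial; fun_prop

theorem hasDerivAt_mul_sqrt (x : ℝ) {u : ℝ} (hu : 0 < u) :
    HasDerivAt (fun u => x * √u) (x * √u / (2 * u)) u := by
  refine ((Real.hasDerivAt_sqrt hu.ne').const_mul x).congr_deriv ?_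
  have h := Real.sq_sqrt hu.le
  have : √u ≠ 0 := by positivity
  field_simp
  rw [h]

/-- The operator u d/du keeps the span of these functions invariant. Each derivative in u therefore
costs one factor 1/u and no power of x. -/
theorem hasDerivAt_gaussMonomial (k : ℕ) (x : ℝ) {u : ℝ} (hu : 0 < u) :
    HasDerivAt (gaussMonomial k x)
      ((k * gaussMonomial k x u - gaussMonomial (k + 2) x u) / (2 * u)) u := by
  have hz := hasDerivAt_mul_sqrt x hu
  have h1 := (hz.pow k).mul ((hasDerivAt_stdNormalDensity (x * √u)).comp u hz)
  refine h1.congr_deriv ?_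
  simp only [gaussMonomial, Function.comp, Pi.pow_apply]
  rcases k with _ | k
  · simp; field_simp
  · simp only [Nat.add_sub_cancel]
    field_simp
    ring

theorem hasDerivAt_stdNormalCdf_mul_sqrt (x : ℝ) {u : ℝ} (hu : 0 < u) :
    HasDerivAt (fun u => stdNormalCdf (x * √u)) (gaussMonomial 1 x u / (2 * u)) u := by
  have h1 := (hasDerivAt_stdNormalCdf (x * √u)).comp u (hasDerivAt_mul_sqrt x hu)
  refine h1.congr_deriv ?_
  simp only [gaussMonomial]; ring


/-! ### Integrals of `t ^ (k - 1 / 2) exp (-t - c² / t)` -/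

theorem integrableOn_exp_neg_div_sqrt :
    IntegrableOn (fun t : ℝ => Real.exp (-t) / √t) (Ioi 0) := by
  refine (Real.GammaIntegral_convergent (s := 1 / 2) (by norm_num)).congr_fun
    (fun t ht => ?_) measurableSet_Ioi
  have ht : (0 : ℝ) < t := ht
  show Real.exp (-t) * t ^ ((1 : ℝ) / 2 - 1) = _
  rw [div_eq_mul_inv _ √t, Real.sqrt_eq_rpow, ← Real.rpow_neg ht.le]
  norm_num

theorem integrableOn_exp_neg_mul_sqrt :
    IntegrableOn (fun t : ℝ => Real.exp (-t) * √t) (Ioi 0) := by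
  refine (Real.GammaIntegral_convergent (s := 3 / 2) (by norm_num)).congr_fun
    (fun t ht => ?_) measurableSet_Ioi
  show Real.exp (-t) * t ^ ((3 : ℝ) / 2 - 1) = _
  rw [Real.sqrt_eq_rpow]
  norm_num

theorem neg_sub_sq_div_le (c : ℝ) {t : ℝ} (ht : 0 < t) :
    -t - c ^ 2 / t ≤ -t := by
  have : 0 ≤ c ^ 2 / t := by positivity
  linarith

theorem integrableOn_besselKernel_div_sqrt (c : ℝ) :
    IntegrableOn (fun t : ℝ => Real.exp (-t - c ^ 2 / t) / √t) (Ioi 0) := by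
  refine integrableOn_of_abs_le measurableSet_Ioi integrableOn_exp_neg_div_sqrt
    (Measurable.aestronglyMeasurable (by fun_prop)) fun t ht => ?_
  rw [abs_of_nonneg (by positivity)]
  gcongr
  exact neg_sub_sq_div_le c ht

theorem integrableOn_besselKernel_mul_sqrt (c : ℝ) :
    IntegrableOn (fun t : ℝ => Real.exp (-t - c ^ 2 / t) * √t) (Ioi 0) := by
  refine integrableOn_of_abs_le measurableSet_Ioi integrableOn_exp_neg_mul_sqrt
    (Measurable.aestronglyMeasurable (by fun_prop)) fun t ht => ?_
  rw [abs_of_nonneg (by positivity)]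
  gcongr
  exact neg_sub_sq_div_le c ht

/-- The factor exp(-c²/t) ≤ t/c² absorbs the singularity at 0. This fails for c = 0, which is why x
= 0 is treated separately in the mixture integrals. -/
theorem integrableOn_besselKernel_div_mul_sqrt {c : ℝ} (hc : c ≠ 0) :
    IntegrableOn (fun t : ℝ => Real.exp (-t - c ^ 2 / t) / (t * √t)) (Ioi 0) := by
  refine integrableOn_of_abs_le measurableSet_Ioi
    (integrableOn_exp_neg_div_sqrt.const_mul (1 / c ^ 2)) (Measurable.aestronglyMeasurable (by fun_prop)) fun t ht => ?_
  have ht : (0 : ℝ) < t := ht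
  rw [abs_of_nonneg (by positivity), sub_eq_add_neg, Real.exp_add]
  have h1 : Real.exp (-(c ^ 2 / t)) ≤ t / c ^ 2 := by
    rw [Real.exp_neg, inv_le_comm₀ (Real.exp_pos _) (by positivity), inv_div]
    linarith [Real.add_one_le_exp (c ^ 2 / t)]
  calc Real.exp (-t) * Real.exp (-(c ^ 2 / t)) / (t * √t)
      ≤ Real.exp (-t) * (t / c ^ 2) / (t * √t) := by gcongr
    _ = 1 / c ^ 2 * (Real.exp (-t) / √t) := by
      have : √t ≠ 0 := by positivity
      field_simp

/-- Completing the square, (√t - c/√t)² = t - 2c + c²/t, so Φ supplies an antiderivative. Using it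
for c and for -c gives two linear equations that determine the integrals of the kernel over √t and
over t√t. -/
theorem hasDerivAt_stdNormalCdf_sqrt_sub (c : ℝ) {t : ℝ} (ht : 0 < t) :
    HasDerivAt (fun t => stdNormalCdf (√2 * (√t - c / √t)))
      (Real.exp (2 * c) / (2 * √Real.pi) * (Real.exp (-t - c ^ 2 / t) / √t
        + c * (Real.exp (-t - c ^ 2 / t) / (t * √t)))) t := by
  have hs : 0 < √t := Real.sqrt_pos.2 ht
  have h1 := Real.hasDerivAt_sqrt ht.ne'
  have h2 := (h1.sub ((hasDerivAt_const t c).div h1 hs.ne')).const_mul √2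
  refine ((hasDerivAt_stdNormalCdf _).comp t h2).congr_deriv ?_
  have hq := Real.sq_sqrt ht.le
  have hexp : -(√2 * (√t - c / √t)) ^ 2 / 2 = 2 * c + (-t - c ^ 2 / t) := by
    rw [mul_pow, Real.sq_sqrt (by norm_num)]
    have : (√t - c / √t) ^ 2 = t - 2 * c + c ^ 2 / t := by
      rw [sub_sq, div_pow, hq]; field_simp
    rw [this]; ring
  have h2pi : √(2 * Real.pi) = √2 * √Real.pi := Real.sqrt_mul (by norm_num) _
  simp only [stdNormalDensity, Pi.sub_apply, Pi.div_apply]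
  rw [hexp, Real.exp_add, h2pi]
  have : √Real.pi ≠ 0 := by positivity
  field_simp
  rw [hq]; ring

theorem tendsto_sqrt_nhdsGT_zero : Tendsto Real.sqrt (𝓝[>] 0) (𝓝[>] 0) := by
  refine tendsto_nhdsWithin_iff.2 ⟨?_, ?_⟩
  · have := (Real.continuous_sqrt.tendsto 0).mono_left (nhdsWithin_le_nhds (s := Ioi 0))
    simpa using this
  · filter_upwards [self_mem_nhdsWithin] with t ht using Real.sqrt_pos.2 ht

theorem tendsto_div_sqrt_nhdsGT_zero {c : ℝ} (hc : 0 < c) :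
    Tendsto (fun t => c / √t) (𝓝[>] 0) atTop := by
  simp only [div_eq_mul_inv]
  exact (tendsto_inv_nhdsGT_zero.comp tendsto_sqrt_nhdsGT_zero).const_mul_atTop hc

theorem tendsto_sqrt_sub_div_atTop (c : ℝ) :
    Tendsto (fun t => √2 * (√t - c / √t)) atTop atTop := by
  refine Tendsto.const_mul_atTop (by positivity) ?_
  simp only [sub_eq_add_neg]
  refine Tendsto.atTop_add (C := 0) Real.tendsto_sqrt_atTop ?_
  simpa using (Real.tendsto_sqrt_atTop.const_div_atTop c).neg

theorem integral_besselKernel_add {c : ℝ} (hc : 0 < c) :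
    ∫ t in Ioi 0, (Real.exp (-t - c ^ 2 / t) / √t + c * (Real.exp (-t - c ^ 2 / t) / (t * √t)))
      = 2 * √Real.pi * Real.exp (-(2 * c)) := by
  have hint := (integrableOn_besselKernel_div_sqrt c).add
    ((integrableOn_besselKernel_div_mul_sqrt hc.ne').const_mul c)
  have h := integral_Ioi_zero_of_hasDerivAt (a := 0) (b := 1)
    (fun t ht => hasDerivAt_stdNormalCdf_sqrt_sub c ht) (hint.const_mul _) ?_
    (tendsto_stdNormalCdf_atTop.comp (tendsto_sqrt_sub_div_atTop c))
  · rw [integral_const_mul] at h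
    have : √Real.pi ≠ 0 := by positivity
    rw [Real.exp_neg]
    field_simp at h ⊢
    linarith
  · refine tendsto_stdNormalCdf_atBot.comp (Tendsto.const_mul_atBot (by positivity) ?_)
    simp only [sub_eq_add_neg]
    exact Tendsto.add_atBot (C := 0) (tendsto_sqrt_nhdsGT_zero.mono_right nhdsWithin_le_nhds)
      (tendsto_neg_atTop_atBot.comp (tendsto_div_sqrt_nhdsGT_zero hc))

/-- With -c in place of c the argument √t + c/√t tends to +∞ at both ends, so the antiderivative has
no net increment. -/
theorem integral_besselKernel_sub {c : ℝ} (hc : 0 < c) :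
    ∫ t in Ioi 0, (Real.exp (-t - c ^ 2 / t) / √t - c * (Real.exp (-t - c ^ 2 / t) / (t * √t)))
      = 0 := by
  have hint := (integrableOn_besselKernel_div_sqrt c).sub
    ((integrableOn_besselKernel_div_mul_sqrt hc.ne').const_mul c)
  have h := integral_Ioi_zero_of_hasDerivAt (a := 1) (b := 1)
    (fun t ht => by
      have := hasDerivAt_stdNormalCdf_sqrt_sub (-c) ht
      rwa [neg_sq, neg_mul, ← sub_eq_add_neg] at this) (hint.const_mul _) ?_
    (tendsto_stdNormalCdf_atTop.comp (tendsto_sqrt_sub_div_atTop (-c)))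
  · rw [integral_const_mul] at h
    have : Real.exp (2 * -c) / (2 * √Real.pi) ≠ 0 := by positivity
    rw [sub_self] at h
    exact (mul_eq_zero.1 h).resolve_left this
  · refine tendsto_stdNormalCdf_atTop.comp (Tendsto.const_mul_atTop (by positivity) ?_)
    simp only [sub_eq_add_neg, neg_div, neg_neg]
    exact Tendsto.add_atTop (C := 0) (tendsto_sqrt_nhdsGT_zero.mono_right nhdsWithin_le_nhds)
      (tendsto_div_sqrt_nhdsGT_zero hc)

theorem integral_besselKernel_div_sqrt {c : ℝ} (hc : 0 < c) :
    ∫ t in Ioi 0, Real.exp (-t - c ^ 2 / t) / √t = √Real.pi * Real.exp (-(2 * c)) := by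
  have h1 := integral_besselKernel_add hc
  have h2 := integral_besselKernel_sub hc
  have i1 := integrableOn_besselKernel_div_sqrt c
  have i2 := (integrableOn_besselKernel_div_mul_sqrt hc.ne').const_mul c
  rw [integral_add i1 i2] at h1
  rw [integral_sub i1 i2] at h2
  linarith

theorem integral_besselKernel_div_mul_sqrt {c : ℝ} (hc : 0 < c) :
    ∫ t in Ioi 0, Real.exp (-t - c ^ 2 / t) / (t * √t) = √Real.pi * Real.exp (-(2 * c)) / c := by
  have h2 := integral_besselKernel_sub hc
  have i1 := integrableOn_besselKernel_div_sqrt c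
  have i2 := (integrableOn_besselKernel_div_mul_sqrt hc.ne').const_mul c
  rw [integral_sub i1 i2, integral_besselKernel_div_sqrt hc, integral_const_mul] at h2
  rw [eq_div_iff hc.ne']
  linarith

/-- The function exp(-t - c²/t) √t vanishes at both ends. Integrating its derivative expresses this
integral through the two already computed. -/
theorem integral_besselKernel_mul_sqrt {c : ℝ} (hc : 0 < c) :
    ∫ t in Ioi 0, Real.exp (-t - c ^ 2 / t) * √t
      = √Real.pi * Real.exp (-(2 * c)) * (1 / 2 + c) := by
  have i0 := integrableOn_besselKernel_mul_sqrt c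
  have i1 := (integrableOn_besselKernel_div_sqrt c).const_mul (1 / 2)
  have i2 := (integrableOn_besselKernel_div_mul_sqrt hc.ne').const_mul (c ^ 2)
  have i12 : IntegrableOn (fun t : ℝ => 1 / 2 * (Real.exp (-t - c ^ 2 / t) / √t)
      + c ^ 2 * (Real.exp (-t - c ^ 2 / t) / (t * √t))) (Ioi 0) := i1.add i2
  have hd : ∀ t ∈ Ioi (0 : ℝ), HasDerivAt (fun t : ℝ => Real.exp (-t - c ^ 2 / t) * √t)
      (1 / 2 * (Real.exp (-t - c ^ 2 / t) / √t)
        + c ^ 2 * (Real.exp (-t - c ^ 2 / t) / (t * √t)) - Real.exp (-t - c ^ 2 / t) * √t) t := by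
    intro t ht
    have ht : (0 : ℝ) < t := ht
    have h1 := (((hasDerivAt_id t).neg.sub
      ((hasDerivAt_const t (c ^ 2)).div (hasDerivAt_id t) ht.ne')).exp).mul
      (Real.hasDerivAt_sqrt ht.ne')
    refine h1.congr_deriv ?_
    have hs : √t ≠ 0 := by positivity
    have hq := Real.sq_sqrt ht.le
    simp only [Pi.sub_apply, Pi.neg_apply, Pi.div_apply, id]
    have h3 : c ^ 2 * (Real.exp (-t - c ^ 2 / t) / (t * √t))
        = c ^ 2 * (Real.exp (-t - c ^ 2 / t) / t ^ 2) * √t := by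
      field_simp
      rw [hq]
    rw [h3]
    field_simp
    ring
  have hbound : ∀ t : ℝ, 0 < t → Real.exp (-t - c ^ 2 / t) * √t ≤ Real.exp (-t) * √t :=
    fun t ht => by
      gcongr
      exact neg_sub_sq_div_le c ht
  have hup : Continuous fun t : ℝ => Real.exp (-t) * √t := by fun_prop
  have h := integral_Ioi_zero_of_hasDerivAt (a := 0) (b := 0) hd (i12.sub i0) ?_ ?_
  · rw [integral_sub i12 i0, integral_add i1 i2, integral_const_mul, integral_const_mul,
      integral_besselKernel_div_sqrt hc, integral_besselKernel_div_mul_sqrt hc] at h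
    field_simp at h ⊢
    linarith
  · refine squeeze_zero' (Eventually.of_forall fun t => by positivity)
      (by filter_upwards [self_mem_nhdsWithin] with t ht using hbound t ht) ?_
    have := (hup.tendsto 0).mono_left (nhdsWithin_le_nhds (s := Ioi 0))
    simpa using this
  · refine squeeze_zero' (Eventually.of_forall fun t => by positivity)
      (by filter_upwards [Ioi_mem_atTop (0 : ℝ)] with t ht using hbound t ht) ?_
    have h1 : Tendsto (fun t : ℝ => t ^ ((1 : ℝ) / 2) * Real.exp (-1 * t)) atTop (𝓝 0) :=
      tendsto_rpow_mul_exp_neg_mul_atTop_nhds_zero _ _ one_pos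
    refine h1.congr fun t => ?_
    rw [Real.sqrt_eq_rpow]; ring_nf


/-! ### Mixtures of Gaussian monomials over an inverse exponential scale -/

/-- At u = s/t the Gaussian exponent is -x²s/(2t), which merges with exp(-t) into the kernel with c
= |x|√(s/2). -/
theorem gaussMonomial_div_mul_exp (k : ℕ) (x : ℝ) {s t : ℝ} (hs : 0 < s) (ht : 0 < t) :
    gaussMonomial k x (s / t) * Real.exp (-t)
      = (x * √s / √t) ^ k / √(2 * Real.pi)
        * Real.exp (-t - (|x| * (√s / √2)) ^ 2 / t) := by
  have h1 : -(x * √(s / t)) ^ 2 / 2 + -t = -t - (|x| * (√s / √2)) ^ 2 / t := by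
    rw [mul_pow, mul_pow, div_pow, sq_abs, Real.sq_sqrt (by positivity), Real.sq_sqrt hs.le,
      Real.sq_sqrt (by norm_num)]
    field_simp
    ring
  rw [← h1, Real.exp_add, gaussMonomial, stdNormalDensity, Real.sqrt_div hs.le]
  ring

theorem laplaceDensity_eq {s : ℝ} (hs : 0 < s) (x : ℝ) :
    laplaceDensity (1 / √s) x = √s / √2 * Real.exp (-(2 * (|x| * (√s / √2)))) := by
  have h2 : (√2 : ℝ) ^ 2 = 2 := Real.sq_sqrt (by norm_num)
  have h3 : -(√2 * |x|) / (1 / √s) = -(2 * (|x| * (√s / √2))) := by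
    field_simp
    rw [h2]
    ring
  rw [laplaceDensity, h3]
  field_simp

theorem gaussMonomial_zero {k : ℕ} (hk : k ≠ 0) (u : ℝ) : gaussMonomial k 0 u = 0 := by
  simp [gaussMonomial, hk]

theorem sqrt_two_mul_pi : √(2 * Real.pi) = √2 * √Real.pi := Real.sqrt_mul (by norm_num) _

theorem integral_gaussMonomial_two {s : ℝ} (hs : 0 < s) (x : ℝ) :
    ∫ t in Ioi 0, gaussMonomial 2 x (s / t) / √(s / t) * Real.exp (-t)
      = laplaceDensity (1 / √s) x * x ^ 2 := by
  rcases eq_or_ne x 0 with rfl | hx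
  · simp [gaussMonomial_zero]
  have hc : 0 < |x| * (√s / √2) := by positivity
  have h1 : ∀ t ∈ Ioi (0 : ℝ), gaussMonomial 2 x (s / t) / √(s / t) * Real.exp (-t)
      = x ^ 2 * √s / √(2 * Real.pi) * (Real.exp (-t - (|x| * (√s / √2)) ^ 2 / t) / √t) := by
    intro t ht
    have ht : (0 : ℝ) < t := ht
    rw [div_mul_eq_mul_div, gaussMonomial_div_mul_exp 2 x hs ht, Real.sqrt_div hs.le]
    have : √t ≠ 0 := by positivity
    have : √s ≠ 0 := by positivity
    field_simp
  rw [setIntegral_congr_fun measurableSet_Ioi h1, integral_const_mul,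
    integral_besselKernel_div_sqrt hc, laplaceDensity_eq hs, sqrt_two_mul_pi]
  have : √Real.pi ≠ 0 := by positivity
  field_simp

theorem integral_gaussMonomial_one {s : ℝ} (hs : 0 < s) (x : ℝ) :
    ∫ t in Ioi 0, gaussMonomial 1 x (s / t) / (s / t) * Real.exp (-t)
      = laplaceDensity (1 / √s) x * (x * (1 + √(2 * s) * |x|) / (2 * s)) := by
  rcases eq_or_ne x 0 with rfl | hx
  · simp [gaussMonomial_zero]
  have hc : 0 < |x| * (√s / √2) := by positivity
  have h1 : ∀ t ∈ Ioi (0 : ℝ), gaussMonomial 1 x (s / t) / (s / t) * Real.exp (-t)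
      = x * √s / s / √(2 * Real.pi) * (Real.exp (-t - (|x| * (√s / √2)) ^ 2 / t) * √t) := by
    intro t ht
    have ht : (0 : ℝ) < t := ht
    rw [div_mul_eq_mul_div, gaussMonomial_div_mul_exp 1 x hs ht]
    have : √t ≠ 0 := by positivity
    have hq := Real.sq_sqrt ht.le
    field_simp
    rw [hq]
  rw [setIntegral_congr_fun measurableSet_Ioi h1, integral_const_mul,
    integral_besselKernel_mul_sqrt hc, laplaceDensity_eq hs, sqrt_two_mul_pi,
    Real.sqrt_mul (by norm_num) s]
  have : √Real.pi ≠ 0 := by positivity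
  have h2 : (√2 : ℝ) ^ 2 = 2 := Real.sq_sqrt (by norm_num)
  field_simp
  linear_combination -(√s * |x|) * h2

theorem integral_gaussMonomial_three {s : ℝ} (hs : 0 < s) (x : ℝ) :
    ∫ t in Ioi 0, gaussMonomial 3 x (s / t) / (s / t) * Real.exp (-t)
      = laplaceDensity (1 / √s) x * x ^ 3 := by
  rcases eq_or_ne x 0 with rfl | hx
  · simp [gaussMonomial_zero]
  have hc : 0 < |x| * (√s / √2) := by positivity
  have h1 : ∀ t ∈ Ioi (0 : ℝ), gaussMonomial 3 x (s / t) / (s / t) * Real.exp (-t)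
      = x ^ 3 * √s / √(2 * Real.pi) * (Real.exp (-t - (|x| * (√s / √2)) ^ 2 / t) / √t) := by
    intro t ht
    have ht : (0 : ℝ) < t := ht
    rw [div_mul_eq_mul_div, gaussMonomial_div_mul_exp 3 x hs ht]
    have : √t ≠ 0 := by positivity
    have : √s ≠ 0 := by positivity
    have hq := Real.sq_sqrt ht.le
    have hq' := Real.sq_sqrt hs.le
    field_simp
    rw [hq, hq']
    ring
  rw [setIntegral_congr_fun measurableSet_Ioi h1, integral_const_mul,
    integral_besselKernel_div_sqrt hc, laplaceDensity_eq hs, sqrt_two_mul_pi]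
  have : √Real.pi ≠ 0 := by positivity
  field_simp

theorem integral_gaussMonomial_five {s : ℝ} (hs : 0 < s) (x : ℝ) :
    ∫ t in Ioi 0, gaussMonomial 5 x (s / t) / (s / t) * Real.exp (-t)
      = laplaceDensity (1 / √s) x * (x ^ 3 * |x| * √(2 * s)) := by
  rcases eq_or_ne x 0 with rfl | hx
  · simp [gaussMonomial_zero]
  have hc : 0 < |x| * (√s / √2) := by positivity
  have h1 : ∀ t ∈ Ioi (0 : ℝ), gaussMonomial 5 x (s / t) / (s / t) * Real.exp (-t)
      = x ^ 5 * √s ^ 3 / √(2 * Real.pi)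
        * (Real.exp (-t - (|x| * (√s / √2)) ^ 2 / t) / (t * √t)) := by
    intro t ht
    have ht : (0 : ℝ) < t := ht
    rw [div_mul_eq_mul_div, gaussMonomial_div_mul_exp 5 x hs ht]
    have : √t ≠ 0 := by positivity
    have : √s ≠ 0 := by positivity
    have hq : √t ^ 5 = t ^ 2 * √t := by
      rw [show √t ^ 5 = (√t ^ 2) ^ 2 * √t by ring, Real.sq_sqrt ht.le]
    have hq' : √s ^ 5 = s * √s ^ 3 := by
      rw [show √s ^ 5 = √s ^ 2 * √s ^ 3 by ring, Real.sq_sqrt hs.le]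
    rw [div_pow, mul_pow, hq, hq']
    field_simp
  rw [setIntegral_congr_fun measurableSet_Ioi h1, integral_const_mul,
    integral_besselKernel_div_mul_sqrt hc, laplaceDensity_eq hs, sqrt_two_mul_pi,
    Real.sqrt_mul (by norm_num) s]
  have : √Real.pi ≠ 0 := by positivity
  have hx' : |x| ≠ 0 := by positivity
  have h5 : x ^ 5 = x ^ 3 * |x| ^ 2 := by rw [sq_abs]; ring
  rw [h5]
  have h2 : (√2 : ℝ) ^ 2 = 2 := Real.sq_sqrt (by norm_num)
  field_simp

/-! ### The Laplace distribution function as a normal mixture. -/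

theorem laplaceCdf_of_nonpos {s : ℝ} (hs : 0 < s) {x : ℝ} (hx : x ≤ 0) :
    laplaceCdf (1 / √s) x = 1 / 2 * Real.exp (-(2 * (|x| * (√s / √2)))) := by
  have hb : 0 < 2 * (√s / √2) := by positivity
  have h1 : ∀ u ∈ Iic x, laplaceDensity (1 / √s) u
      = √s / √2 * Real.exp (2 * (√s / √2) * u) := by
    intro u hu
    have hu : u ≤ 0 := le_trans hu hx
    rw [laplaceDensity_eq hs, abs_of_nonpos hu]
    ring_nf
  rw [laplaceCdf, setIntegral_congr_fun measurableSet_Iic h1, integral_const_mul,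
    integral_exp_mul_Iic hb, abs_of_nonpos hx]
  rw [show -(2 * (-x * (√s / √2))) = 2 * (√s / √2) * x by ring]
  field_simp

theorem laplaceCdf_of_nonneg {s : ℝ} (hs : 0 < s) {x : ℝ} (hx : 0 ≤ x) :
    laplaceCdf (1 / √s) x = 1 - 1 / 2 * Real.exp (-(2 * (|x| * (√s / √2)))) := by
  have hb : 0 < 2 * (√s / √2) := by positivity
  have hpos : ∀ u ∈ Ioi (0 : ℝ), laplaceDensity (1 / √s) u
      = √s / √2 * Real.exp (-(2 * (√s / √2)) * u) := by
    intro u hu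
    rw [laplaceDensity_eq hs, abs_of_pos hu]
    ring_nf
  have hint0 : IntegrableOn (laplaceDensity (1 / √s)) (Ioi 0) :=
    IntegrableOn.congr_fun
      (f := fun u => √s / √2 * Real.exp (-(2 * (√s / √2)) * u))
      ((integrableOn_exp_mul_Ioi (neg_lt_zero.2 hb) 0).const_mul _)
      (fun u hu => (hpos u hu).symm) measurableSet_Ioi
  have h0 := laplaceCdf_of_nonpos hs le_rfl
  have hneg : IntegrableOn (laplaceDensity (1 / √s)) (Iic 0) := by
    -- A non-integrable function has integral 0 by convention, so the value 1/2 already found at 0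
    -- proves integrability.
    by_contra h
    have h1 : laplaceCdf (1 / √s) 0 = 0 := integral_undef h
    rw [h1] at h0
    simp at h0
  have hall : Integrable (laplaceDensity (1 / √s)) := by
    rw [← integrableOn_univ, ← Iic_union_Ioi (a := (0 : ℝ))]
    exact hneg.union hint0
  have htail : ∫ u in Ioi x, laplaceDensity (1 / √s) u
      = 1 / 2 * Real.exp (-(2 * (|x| * (√s / √2)))) := by
    rw [setIntegral_congr_fun measurableSet_Ioi
      (fun u hu => hpos u (lt_of_le_of_lt hx hu)), integral_const_mul,
      integral_exp_mul_Ioi (by linarith), abs_of_nonneg hx,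
      show -(2 * (x * (√s / √2))) = -(2 * (√s / √2)) * x by ring]
    field_simp
  have htail0 : ∫ u in Ioi 0, laplaceDensity (1 / √s) u = 1 / 2 := by
    rw [setIntegral_congr_fun measurableSet_Ioi (fun u hu => hpos u hu), integral_const_mul,
      integral_exp_mul_Ioi (by linarith)]
    simp
    field_simp
  have e1 := intervalIntegral.integral_Iic_add_Ioi (μ := volume) (b := x)
    hall.integrableOn hall.integrableOn
  have e2 := intervalIntegral.integral_Iic_add_Ioi (μ := volume) (b := (0 : ℝ))
    hall.integrableOn hall.integrableOn
  rw [laplaceCdf] at h0 ⊢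
  rw [htail] at e1
  rw [htail0, h0] at e2
  rw [abs_zero, zero_mul, mul_zero, neg_zero, Real.exp_zero] at e2
  linarith

theorem tendsto_sqrt_div_nhdsGT_zero {s : ℝ} (hs : 0 < s) :
    Tendsto (fun t => √(s / t)) (𝓝[>] 0) atTop := by
  refine (tendsto_div_sqrt_nhdsGT_zero (Real.sqrt_pos.2 hs)).congr fun t => ?_
  rw [Real.sqrt_div hs.le]

theorem integral_gaussMonomial_one_div_two_mul {s : ℝ} (hs : 0 < s) {x : ℝ} (hx : x ≠ 0) :
    IntegrableOn (fun t => gaussMonomial 1 x (s / t) / (2 * t) * Real.exp (-t)) (Ioi 0) ∧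
    ∫ t in Ioi 0, gaussMonomial 1 x (s / t) / (2 * t) * Real.exp (-t)
      = 1 / 2 * (x / |x|) * Real.exp (-(2 * (|x| * (√s / √2)))) := by
  have hc : 0 < |x| * (√s / √2) := by positivity
  have h1 : ∀ t ∈ Ioi (0 : ℝ), gaussMonomial 1 x (s / t) / (2 * t) * Real.exp (-t)
      = x * √s / 2 / √(2 * Real.pi)
        * (Real.exp (-t - (|x| * (√s / √2)) ^ 2 / t) / (t * √t)) := by
    intro t ht
    have ht : (0 : ℝ) < t := ht
    rw [div_mul_eq_mul_div, gaussMonomial_div_mul_exp 1 x hs ht]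
    have : √t ≠ 0 := by positivity
    field_simp
  refine ⟨IntegrableOn.congr_fun
    ((integrableOn_besselKernel_div_mul_sqrt hc.ne').const_mul (x * √s / 2 / √(2 * Real.pi)))
    (fun t ht => (h1 t ht).symm) measurableSet_Ioi, ?_⟩
  rw [setIntegral_congr_fun measurableSet_Ioi h1, integral_const_mul,
    integral_besselKernel_div_mul_sqrt hc, sqrt_two_mul_pi]
  have : √Real.pi ≠ 0 := by positivity
  have hx' : |x| ≠ 0 := by positivity
  field_simp

/-- Integration by parts in t leaves one of the kernel integrals and the boundary value of
Φ(x√(s/t)) at 0+. That value is 0 or 1 according to the sign of x, which yields the two branches of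
the Laplace distribution function. -/
theorem integral_stdNormalCdf_eq_laplaceCdf {s : ℝ} (hs : 0 < s) (x : ℝ) :
    ∫ t in Ioi 0, stdNormalCdf (x * √(s / t)) * Real.exp (-t) = laplaceCdf (1 / √s) x := by
  rcases eq_or_ne x 0 with rfl | hx
  · rw [laplaceCdf_of_nonpos hs le_rfl]
    simp only [zero_mul, stdNormalCdf_zero, integral_const_mul, integral_exp_neg_Ioi_zero,
      abs_zero, mul_zero, neg_zero, Real.exp_zero]
  obtain ⟨i1, h1⟩ := integral_gaussMonomial_one_div_two_mul hs hx
  have hΦ := continuous_stdNormalCdf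
  have i0 : IntegrableOn (fun t => stdNormalCdf (x * √(s / t)) * Real.exp (-t)) (Ioi 0) := by
    refine integrableOn_of_abs_le measurableSet_Ioi integrableOn_exp_neg
      (Measurable.aestronglyMeasurable ?_) fun t _ => ?_
    · have := hΦ.measurable
      fun_prop
    · rw [abs_mul, abs_of_pos (Real.exp_pos _)]
      exact mul_le_of_le_one_left (Real.exp_pos _).le (abs_stdNormalCdf_le _)
  have hd : ∀ t ∈ Ioi (0 : ℝ), HasDerivAt (fun t => -(stdNormalCdf (x * √(s / t)) * Real.exp (-t)))
      (stdNormalCdf (x * √(s / t)) * Real.exp (-t)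
        + gaussMonomial 1 x (s / t) / (2 * t) * Real.exp (-t)) t := by
    intro t ht
    have ht : (0 : ℝ) < t := ht
    have h2 := (hasDerivAt_stdNormalCdf_mul_sqrt x (div_pos hs ht)).comp t
      ((hasDerivAt_const t s).div (hasDerivAt_id t) ht.ne')
    refine ((h2.mul (hasDerivAt_id t).neg.exp).neg).congr_deriv ?_
    simp only [Function.comp, Pi.neg_apply, id]
    field_simp
    ring
  have htop : Tendsto (fun t => -(stdNormalCdf (x * √(s / t)) * Real.exp (-t))) atTop (𝓝 0) := by
    refine squeeze_zero_norm (a := fun t => Real.exp (-t)) (fun t => ?_)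
      Real.tendsto_exp_neg_atTop_nhds_zero
    rw [norm_neg, Real.norm_eq_abs, abs_mul, abs_of_pos (Real.exp_pos _)]
    exact mul_le_of_le_one_left (Real.exp_pos _).le (abs_stdNormalCdf_le _)
  have hexp : Tendsto (fun t : ℝ => Real.exp (-t)) (𝓝[>] 0) (𝓝 1) := by
    have : Continuous fun t : ℝ => Real.exp (-t) := by fun_prop
    simpa using (this.tendsto 0).mono_left (nhdsWithin_le_nhds (s := Ioi 0))
  have key : ∀ a, Tendsto (fun t => stdNormalCdf (x * √(s / t))) (𝓝[>] 0) (𝓝 a) →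
      ∫ t in Ioi 0, stdNormalCdf (x * √(s / t)) * Real.exp (-t)
        = a - 1 / 2 * (x / |x|) * Real.exp (-(2 * (|x| * (√s / √2)))) := by
    intro a ha
    have h0 := (ha.mul hexp).neg
    rw [mul_one] at h0
    have h := integral_Ioi_zero_of_hasDerivAt hd (i0.add i1) h0 htop
    rw [integral_add i0 i1, h1] at h
    linarith
  rcases lt_or_gt_of_ne hx with hx | hx
  · rw [key 0, laplaceCdf_of_nonpos hs hx.le, abs_of_neg hx, div_neg, div_self hx.ne]
    · ring
    · exact tendsto_stdNormalCdf_atBot.comp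
        ((tendsto_sqrt_div_nhdsGT_zero hs).const_mul_atTop_of_neg hx)
  · rw [key 1, laplaceCdf_of_nonneg hs hx.le, abs_of_pos hx, div_self hx.ne']
    · ring
    · exact tendsto_stdNormalCdf_atTop.comp
        ((tendsto_sqrt_div_nhdsGT_zero hs).const_mul_atTop hx)


/-! ### Coupling of the sample size with an exponential variable -/

theorem exp_sub_one_pos {τ : ℝ} (hτ : 0 < τ) : 0 < Real.exp τ - 1 :=
  sub_pos.2 (Real.one_lt_exp_iff.2 hτ)

theorem one_div_exp_sub_one_le {τ : ℝ} (hτ : 0 < τ) : 1 / (Real.exp τ - 1) ≤ 1 / τ :=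
  one_div_le_one_div_of_le hτ (by linarith [Real.add_one_le_exp τ])

theorem one_div_sub_one_le {τ : ℝ} (hτ : 0 < τ) : 1 / τ - 1 ≤ 1 / (Real.exp τ - 1) := by
  have h1 := exp_sub_one_pos hτ
  have h2 : (1 - τ) * Real.exp τ ≤ 1 := by
    have := Real.add_one_le_exp (-τ)
    calc (1 - τ) * Real.exp τ ≤ Real.exp (-τ) * Real.exp τ := by gcongr; linarith
      _ = 1 := by rw [← Real.exp_add]; simp
  rw [le_div_iff₀ h1, sub_mul, div_mul_eq_mul_div, one_mul, sub_le_iff_le_add,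
    div_le_iff₀ hτ]
  nlinarith

/-- The Laurent expansion at 0 starts with 1/τ - 1/2. For τ ≥ 1 the crude two-sided bounds suffice,
so the linear error holds on the whole half line. -/
theorem abs_one_div_exp_sub_one_le {τ : ℝ} (hτ : 0 < τ) :
    |1 / (Real.exp τ - 1) - 1 / τ + 1 / 2| ≤ 2 * τ := by
  have h1 := exp_sub_one_pos hτ
  rcases le_total 1 τ with h | h
  · have a := one_div_exp_sub_one_le hτ
    have b := one_div_sub_one_le hτ
    rw [abs_le]; constructor <;> linarith
  · have hb := Real.exp_bound (x := τ) (by rwa [abs_of_pos hτ]) (n := 3) (by norm_num)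
    simp only [Finset.sum_range_succ, Finset.sum_range_zero, abs_of_pos hτ] at hb
    norm_num [Nat.factorial] at hb
    obtain ⟨hb1, hb2⟩ := abs_le.1 hb
    have h3 : τ ^ 3 ≤ τ ^ 2 := by nlinarith [sq_nonneg τ]
    have h4 : 0 < τ ^ 3 := by positivity
    have h5 : τ ≤ Real.exp τ - 1 := by linarith [Real.add_one_le_exp τ]
    have heq : 1 / (Real.exp τ - 1) - 1 / τ + 1 / 2
        = (2 * τ - 2 * (Real.exp τ - 1) + τ * (Real.exp τ - 1)) / (2 * τ * (Real.exp τ - 1)) := by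
      field_simp
    rw [heq, abs_div, abs_of_pos (a := 2 * τ * (Real.exp τ - 1)) (by positivity),
      div_le_iff₀ (by positivity)]
    have h6 : |2 * τ - 2 * (Real.exp τ - 1) + τ * (Real.exp τ - 1)| ≤ 4 * τ ^ 3 := by
      rw [abs_le]; constructor <;> nlinarith
    calc _ ≤ 4 * τ ^ 3 := h6
      _ = 2 * τ * (2 * τ * τ) := by ring
      _ ≤ _ := by gcongr

/-- The quantile transform `V` of the continuous analogue `y ↦ (y / (s + y)) ^ n` of the
distribution function of `N_n`, in terms of an exponential variable `t`. -/
noncomputable def paretoQuantile (s : ℝ) (n : ℕ) (t : ℝ) : ℝ := s / (Real.exp (t / n) - 1)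

/-- If `t` is a standard exponential variable, then `paretoCeil s n t` has the law of `N_n`. -/
noncomputable def paretoCeil (s : ℝ) (n : ℕ) (t : ℝ) : ℕ := ⌈paretoQuantile s n t⌉₊

section Coupling

variable {s : ℝ} {n : ℕ} {t : ℝ}

theorem measurable_paretoQuantile (s : ℝ) (n : ℕ) : Measurable (paretoQuantile s n) := by
  unfold paretoQuantile; fun_prop

theorem measurable_paretoCeil (s : ℝ) (n : ℕ) : Measurable (paretoCeil s n) :=
  Nat.measurable_ceil.comp (measurable_paretoQuantile s n)

theorem paretoQuantile_pos (hs : 0 < s) (hn : 1 ≤ n) (ht : 0 < t) : 0 < paretoQuantile s n t := by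
  have hn' : (0 : ℝ) < n := by exact_mod_cast hn
  exact div_pos hs (exp_sub_one_pos (by positivity))

theorem one_le_paretoCeil (hs : 0 < s) (hn : 1 ≤ n) (ht : 0 < t) : 1 ≤ paretoCeil s n t :=
  Nat.ceil_pos.2 (paretoQuantile_pos hs hn ht)

theorem paretoQuantile_le_paretoCeil : paretoQuantile s n t ≤ paretoCeil s n t := Nat.le_ceil _

theorem paretoCeil_lt (hs : 0 < s) (hn : 1 ≤ n) (ht : 0 < t) :
    (paretoCeil s n t : ℝ) < paretoQuantile s n t + 1 :=
  Nat.ceil_lt_add_one (paretoQuantile_pos hs hn ht).le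

/-- The centred rounding error of `paretoCeil`. -/
noncomputable def roundingError (s : ℝ) (n : ℕ) (t : ℝ) : ℝ :=
  paretoCeil s n t - paretoQuantile s n t - 1 / 2

theorem measurable_roundingError (s : ℝ) (n : ℕ) : Measurable (roundingError s n) := by
  have h1 := measurable_paretoQuantile s n
  have h2 : Measurable fun t => (paretoCeil s n t : ℝ) :=
    measurable_from_nat.comp (measurable_paretoCeil s n)
  unfold roundingError; fun_prop

theorem abs_roundingError_le (hs : 0 < s) (hn : 1 ≤ n) (ht : 0 < t) :
    |roundingError s n t| ≤ 1 / 2 := by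
  have h1 := paretoQuantile_le_paretoCeil (s := s) (n := n) (t := t)
  have h2 := paretoCeil_lt hs hn ht
  rw [roundingError, abs_le]; constructor <;> linarith

theorem paretoQuantile_le (hs : 0 < s) (hn : 1 ≤ n) (ht : 0 < t) :
    paretoQuantile s n t ≤ n * (s / t) := by
  have hn' : (0 : ℝ) < n := by exact_mod_cast hn
  have h := mul_le_mul_of_nonneg_left (one_div_exp_sub_one_le (τ := t / n) (by positivity)) hs.le
  calc paretoQuantile s n t = s * (1 / (Real.exp (t / n) - 1)) := by rw [paretoQuantile]; ring
    _ ≤ _ := h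
    _ = _ := by field_simp

theorem le_paretoQuantile (hs : 0 < s) (hn : 1 ≤ n) (ht : 0 < t) :
    n * (s / t) - s ≤ paretoQuantile s n t := by
  have hn' : (0 : ℝ) < n := by exact_mod_cast hn
  have h := mul_le_mul_of_nonneg_left (one_div_sub_one_le (τ := t / n) (by positivity)) hs.le
  calc n * (s / t) - s = s * (1 / (t / n) - 1) := by field_simp
    _ ≤ _ := h
    _ = _ := by rw [paretoQuantile]; ring

theorem abs_paretoCeil_div_sub_le (hs : 0 < s) (hn : 1 ≤ n) (ht : 0 < t) :
    |(paretoCeil s n t : ℝ) / n - s / t| ≤ (1 + s) / n := by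
  have hn' : (0 : ℝ) < n := by exact_mod_cast hn
  have h1 := paretoQuantile_le_paretoCeil (s := s) (n := n) (t := t)
  have h2 := paretoCeil_lt hs hn ht
  have h3 := paretoQuantile_le hs hn ht
  have h4 := le_paretoQuantile hs hn ht
  have h5 : (paretoCeil s n t : ℝ) / n - s / t = (paretoCeil s n t - n * (s / t)) / n := by
    field_simp
  rw [h5, abs_div, abs_of_pos hn']
  gcongr
  rw [abs_le]; constructor <;> linarith

/-- The shift (1 - s)/2 has two sources: 1/2 from centring the rounding error, and -s/2 from the
constant term of 1/(exp τ - 1) at τ = t/n. -/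
theorem abs_paretoCeil_div_sub_sub_le (hs : 0 < s) (hn : 1 ≤ n) (ht : 0 < t) :
    |(paretoCeil s n t : ℝ) / n - s / t - (roundingError s n t + (1 - s) / 2) / n|
      ≤ 2 * s * t / n ^ 2 := by
  have hn' : (0 : ℝ) < n := by exact_mod_cast hn
  have h := abs_one_div_exp_sub_one_le (τ := t / n) (by positivity)
  have h5 : (paretoCeil s n t : ℝ) / n - s / t - (roundingError s n t + (1 - s) / 2) / n
      = s / n * (1 / (Real.exp (t / n) - 1) - 1 / (t / n) + 1 / 2) := by
    rw [roundingError, paretoQuantile]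
    field_simp
    ring
  rw [h5, abs_mul, abs_of_pos (by positivity)]
  calc _ ≤ s / n * (2 * (t / n)) := by gcongr
    _ = _ := by field_simp

/-- For t ≤ n this follows from exp τ - 1 ≤ 2τ, and for t ≥ n from N ≥ 1. Being uniform in n, it
turns negative powers of N/n into powers of t, which are integrable against exp(-t). -/
theorem one_div_le_paretoCeil_div (hs : 0 < s) (hn : 1 ≤ n) (ht : 0 < t) :
    1 / ((1 + 2 / s) * t) ≤ (paretoCeil s n t : ℝ) / n := by
  have hn' : (0 : ℝ) < n := by exact_mod_cast hn
  have hN : (1 : ℝ) ≤ paretoCeil s n t := by exact_mod_cast one_le_paretoCeil hs hn ht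
  rw [div_le_div_iff₀ (by positivity) hn', one_mul]
  have h2s : 0 < 2 / s := by positivity
  rcases le_total (t / n) 1 with h | h
  · have h1 := Real.abs_exp_sub_one_le (x := t / n) (by rwa [abs_of_pos (by positivity)])
    have h2 := (abs_le.1 h1).2
    rw [abs_of_pos (by positivity : 0 < t / (n : ℝ))] at h2
    have h3 : s / (2 * (t / n)) ≤ paretoQuantile s n t := by
      rw [paretoQuantile]
      have := exp_sub_one_pos (τ := t / n) (by positivity)
      gcongr
    have h4 := h3.trans (paretoQuantile_le_paretoCeil (s := s) (n := n) (t := t))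
    calc (n : ℝ) = s / (2 * (t / n)) * (2 / s * t) := by field_simp
      _ ≤ paretoCeil s n t * ((1 + 2 / s) * t) := by gcongr; linarith
  · rw [le_div_iff₀ hn', one_mul] at h
    calc (n : ℝ) ≤ 1 * (1 * t) := by linarith
      _ ≤ paretoCeil s n t * ((1 + 2 / s) * t) := by gcongr; linarith

theorem one_div_le_div (hs : 0 < s) (ht : 0 < t) : 1 / ((1 + 2 / s) * t) ≤ s / t := by
  rw [div_le_div_iff₀ (by positivity) ht]
  have : s * ((1 + 2 / s) * t) = s * t + 2 * t := by field_simp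
  rw [this]; nlinarith [mul_pos hs ht]

theorem abs_sub_le_of_hasDerivAt {g g' : ℝ → ℝ} {a u v M : ℝ} (hu : a ≤ u) (hv : a ≤ v)
    (hg : ∀ w, a ≤ w → HasDerivAt g (g' w) w) (hM : ∀ w, a ≤ w → |g' w| ≤ M) :
    |g v - g u| ≤ M * |v - u| :=
  (convex_Ici a).norm_image_sub_le_of_norm_hasDerivWithin_le
    (fun w hw => (hg w hw).hasDerivWithinAt) (fun w hw => hM w hw) hu hv

/-- The mean value inequality is applied to w ↦ g w - g' u * w; the sharp factor 1/2 is not needed.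
-/
theorem abs_sub_sub_mul_le_of_hasDerivAt {g g' g'' : ℝ → ℝ} {a u v M : ℝ} (hu : a ≤ u)
    (hv : a ≤ v) (hg : ∀ w, a ≤ w → HasDerivAt g (g' w) w)
    (hg' : ∀ w, a ≤ w → HasDerivAt g' (g'' w) w) (hM : ∀ w, a ≤ w → |g'' w| ≤ M) :
    |g v - g u - g' u * (v - u)| ≤ M * |v - u| ^ 2 := by
  have hM0 : 0 ≤ M := (abs_nonneg _).trans (hM u hu)
  have h := (convex_uIcc u v).norm_image_sub_le_of_norm_hasDerivWithin_le
    (f := fun w => g w - g' u * w) (f' := fun w => g' w - g' u) (C := M * |v - u|)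
    (x := u) (y := v) (fun w hw => ?_) (fun w hw => ?_) left_mem_uIcc right_mem_uIcc
  · simp only [Real.norm_eq_abs] at h
    calc _ = |g v - g' u * v - (g u - g' u * u)| := by congr 1; ring
      _ ≤ _ := h
      _ = _ := by ring
  · have hw' : a ≤ w := (le_min hu hv).trans hw.1
    refine ((hg w hw').sub ((hasDerivAt_id w).const_mul (g' u))).hasDerivWithinAt.congr_deriv ?_
    simp
  · have hw' : a ≤ w := (le_min hu hv).trans hw.1
    exact (abs_sub_le_of_hasDerivAt hu hw' hg' hM).trans
      (mul_le_mul_of_nonneg_left (abs_sub_left_of_mem_uIcc hw) hM0)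

theorem integrableOn_comp_paretoCeil {g : ℝ → ℝ} {K : ℝ} (hg : Measurable g) (hs : 0 < s)
    (hn : 1 ≤ n) (hK : 0 ≤ K) (h0 : ∀ u, 0 < u → |g u| ≤ K * (1 + 1 / u)) :
    IntegrableOn (fun t => g ((paretoCeil s n t : ℝ) / n) * Real.exp (-t)) (Ioi 0) := by
  have hn' : (0 : ℝ) < n := by exact_mod_cast hn
  have hN : Measurable fun t => (paretoCeil s n t : ℝ) :=
    measurable_from_nat.comp (measurable_paretoCeil s n)
  have hi := (integrableOn_exp_neg.add
    ((integrableOn_pow_mul_exp_neg 1 one_pos).const_mul (1 + 2 / s))).const_mul K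
  refine integrableOn_of_abs_le measurableSet_Ioi hi
    (Measurable.aestronglyMeasurable (by fun_prop)) fun t ht => ?_
  have ht : (0 : ℝ) < t := ht
  have h1 := one_div_le_paretoCeil_div hs hn ht
  have hpos : 0 < 1 / ((1 + 2 / s) * t) := by positivity
  have h2 : 1 / ((paretoCeil s n t : ℝ) / n) ≤ (1 + 2 / s) * t := by
    have := one_div_le_one_div_of_le hpos h1
    rwa [one_div_one_div] at this
  rw [abs_mul, abs_of_pos (Real.exp_pos _)]
  calc _ ≤ K * (1 + (1 + 2 / s) * t) * Real.exp (-t) := by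
        gcongr
        exact (h0 _ (hpos.trans_le h1)).trans (by gcongr)
    _ = _ := by simp; ring

theorem integrableOn_comp_div {g : ℝ → ℝ} {K : ℝ} (hg : Measurable g) (hs : 0 < s)
    (h0 : ∀ u, 0 < u → |g u| ≤ K * (1 + 1 / u)) :
    IntegrableOn (fun t => g (s / t) * Real.exp (-t)) (Ioi 0) := by
  have hi := (integrableOn_exp_neg.add
    ((integrableOn_pow_mul_exp_neg 1 one_pos).const_mul (1 / s))).const_mul K
  refine integrableOn_of_abs_le measurableSet_Ioi hi
    (Measurable.aestronglyMeasurable (by fun_prop)) fun t ht => ?_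
  have ht : (0 : ℝ) < t := ht
  rw [abs_mul, abs_of_pos (Real.exp_pos _)]
  calc _ ≤ K * (1 + 1 / (s / t)) * Real.exp (-t) := by
        gcongr
        exact h0 _ (by positivity)
    _ = _ := by simp; ring

/-- Both s/t and N/n lie to the right of 1/(κt) and differ by at most (1+s)/n, so the mean value
inequality applies. The constant depends on s alone, and `g` enters only through `K`; this gives
uniformity in x. -/
theorem exists_abs_integral_paretoCeil_sub_le (hs : 0 < s) :
    ∃ C : ℝ, 0 ≤ C ∧ ∀ (g g' : ℝ → ℝ) (K : ℝ), 0 ≤ K → Measurable g →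
      (∀ u, 0 < u → HasDerivAt g (g' u) u) → (∀ u, 0 < u → |g u| ≤ K * (1 + 1 / u)) →
      (∀ u, 0 < u → |g' u| ≤ K * (1 + 1 / u ^ 2)) → ∀ n : ℕ, 1 ≤ n →
      |(∫ t in Ioi 0, g ((paretoCeil s n t : ℝ) / n) * Real.exp (-t))
          - ∫ t in Ioi 0, g (s / t) * Real.exp (-t)| ≤ C * K / n := by
  set κ := 1 + 2 / s with hκ
  have hκ0 : 0 < κ := by positivity
  have hB : IntegrableOn (fun t => (1 + s) * (Real.exp (-t)
      + κ ^ 2 * (t ^ 2 * Real.exp (-(1 * t))))) (Ioi 0) :=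
    (integrableOn_exp_neg.add
      ((integrableOn_pow_mul_exp_neg 2 one_pos).const_mul (κ ^ 2))).const_mul (1 + s)
  refine ⟨∫ t in Ioi 0, (1 + s) * (Real.exp (-t) + κ ^ 2 * (t ^ 2 * Real.exp (-(1 * t)))),
    setIntegral_nonneg measurableSet_Ioi fun t _ => by positivity, ?_⟩
  intro g g' K hK hgm hg h0 h1 n hn
  have hn' : (0 : ℝ) < n := by exact_mod_cast hn
  rw [← integral_sub (integrableOn_comp_paretoCeil hgm hs hn hK h0)
    (integrableOn_comp_div hgm hs h0), mul_div_assoc, ← integral_mul_const, ← Real.norm_eq_abs]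
  refine norm_integral_le_of_norm_le (hB.mul_const _)
    ((ae_restrict_iff' measurableSet_Ioi).2 (Eventually.of_forall fun t ht => ?_))
  have ht : (0 : ℝ) < t := ht
  have hpos : 0 < 1 / (κ * t) := by positivity
  have h2 := abs_sub_le_of_hasDerivAt (M := K * (1 + (κ * t) ^ 2))
    (one_div_le_div hs ht) (one_div_le_paretoCeil_div hs hn ht)
    (fun w hw => hg w (hpos.trans_le hw)) (fun w hw => (h1 w (hpos.trans_le hw)).trans (by
      have : 1 / w ≤ κ * t := by
        have := one_div_le_one_div_of_le hpos hw
        rwa [one_div_one_div] at this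
      have hw0 : 0 < 1 / w := one_div_pos.2 (hpos.trans_le hw)
      rw [← one_div_pow]
      gcongr))
  rw [← sub_mul, Real.norm_eq_abs, abs_mul, abs_of_pos (Real.exp_pos _)]
  calc _ ≤ K * (1 + (κ * t) ^ 2) * ((1 + s) / n) * Real.exp (-t) := by
        gcongr
        refine h2.trans ?_
        gcongr
        exact abs_paretoCeil_div_sub_le hs hn ht
    _ = _ := by rw [one_mul]; ring

end Coupling


/-! ### The averaged rounding error -/

/-- A periodic antiderivative of the sawtooth function `1 / 2 - fract`. -/
noncomputable def sawtoothPrimitive (y : ℝ) : ℝ := Int.fract y * (1 - Int.fract y) / 2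

theorem continuous_sawtoothPrimitive : Continuous sawtoothPrimitive := by
  have h : Continuous fun y : ℝ => y * (1 - y) / 2 := by fun_prop
  exact h.continuousOn.comp_fract'' (by norm_num)

theorem abs_sawtoothPrimitive_le (y : ℝ) : |sawtoothPrimitive y| ≤ 1 := by
  have h0 := Int.fract_nonneg y
  have h1 := (Int.fract_lt_one y).le
  rw [sawtoothPrimitive, abs_le]
  constructor <;> nlinarith

theorem hasDerivAt_sawtoothPrimitive {y : ℝ} (hy : Int.fract y ≠ 0) :
    HasDerivAt sawtoothPrimitive (1 / 2 - Int.fract y) y := by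
  have hlt : (⌊y⌋ : ℝ) < y := (Int.floor_le y).lt_of_ne fun h => hy (by
    rw [Int.fract]; linarith)
  have h1 : HasDerivAt (fun v : ℝ => (v - ⌊y⌋) * (1 - (v - ⌊y⌋)) / 2) (1 / 2 - Int.fract y) y := by
    have h := (hasDerivAt_id y).sub_const (⌊y⌋ : ℝ)
    refine ((h.mul (h.const_sub 1)).div_const 2).congr_deriv ?_
    simp only [Int.fract, id]; ring
  refine h1.congr_of_eventuallyEq ?_
  filter_upwards [Ioo_mem_nhds hlt (Int.lt_floor_add_one y)] with v hv
  have : ⌊v⌋ = ⌊y⌋ := Int.floor_eq_iff.2 ⟨hv.1.le, hv.2⟩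
  simp only [sawtoothPrimitive, Int.fract, this]

theorem exp_sub_one_le_mul_exp {τ : ℝ} : Real.exp τ - 1 ≤ τ * Real.exp τ := by
  have h := Real.add_one_le_exp (-τ)
  have h2 : Real.exp (-τ) * Real.exp τ = 1 := by rw [← Real.exp_add]; simp
  nlinarith [Real.exp_pos τ]

theorem exp_add_exp_neg_sub_two (τ : ℝ) :
    Real.exp τ + Real.exp (-τ) - 2 = (Real.exp τ - 1) ^ 2 / Real.exp τ := by
  rw [Real.exp_neg]; field_simp; ring

theorem exp_add_exp_neg_sub_two_nonneg (τ : ℝ) : 0 ≤ Real.exp τ + Real.exp (-τ) - 2 := by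
  rw [exp_add_exp_neg_sub_two]; positivity

theorem exp_add_exp_neg_sub_two_le {τ : ℝ} (hτ : 0 < τ) :
    Real.exp τ + Real.exp (-τ) - 2 ≤ τ ^ 2 * Real.exp τ := by
  have h1 := exp_sub_one_pos hτ
  rw [exp_add_exp_neg_sub_two, div_le_iff₀ (Real.exp_pos _)]
  calc (Real.exp τ - 1) ^ 2 ≤ (τ * Real.exp τ) ^ 2 := by gcongr; exact exp_sub_one_le_mul_exp
    _ = _ := by ring

theorem abs_exp_sub_exp_neg_le {τ : ℝ} (hτ : 0 < τ) :
    |Real.exp τ - Real.exp (-τ)| ≤ 2 * τ * Real.exp τ := by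
  have h1 := Real.add_one_le_exp (-(2 * τ))
  have h2 : Real.exp (-τ) = Real.exp τ * Real.exp (-(2 * τ)) := by
    rw [← Real.exp_add]; ring_nf
  have h3 : Real.exp (-(2 * τ)) ≤ 1 := Real.exp_le_one_iff.2 (by linarith)
  have h4 := Real.exp_pos τ
  rw [h2, abs_of_nonneg (by nlinarith)]
  nlinarith

section Rounding

variable {s : ℝ} {n : ℕ}

theorem hasDerivAt_paretoQuantile (hn : 1 ≤ n) {t : ℝ} (ht : 0 < t) :
    HasDerivAt (paretoQuantile s n)
      (-(s / n) / (Real.exp (t / n) + Real.exp (-(t / n)) - 2)) t := by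
  have hn' : (0 : ℝ) < n := by exact_mod_cast hn
  have h0 := exp_sub_one_pos (τ := t / n) (by positivity)
  have h1 := (((hasDerivAt_id t).div_const (n : ℝ)).exp).sub_const 1
  refine ((hasDerivAt_const t s).div h1 h0.ne').congr_deriv ?_
  rw [exp_add_exp_neg_sub_two]
  simp only [id]
  field_simp
  ring

/-- At integer values of the quantile the sawtooth primitive has a corner and the rounding error is
not 1/2 minus the fractional part. Each integer m ≠ 0 is hit only at t = n log(1 + s/m). -/
theorem countable_paretoQuantile_integer (hs : 0 < s) (hn : 1 ≤ n) :
    ∃ S : Set ℝ, S.Countable ∧ ∀ t ∈ Ioi (0 : ℝ) \ S, Int.fract (paretoQuantile s n t) ≠ 0 := by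
  have hn' : (0 : ℝ) < n := by exact_mod_cast hn
  refine ⟨range fun m : ℤ => n * Real.log (1 + s / m), countable_range _, fun t ht h => ht.2 ?_⟩
  have ht0 : (0 : ℝ) < t := ht.1
  refine ⟨⌊paretoQuantile s n t⌋, ?_⟩
  have h1 : (⌊paretoQuantile s n t⌋ : ℝ) = paretoQuantile s n t := by
    rw [Int.fract] at h; linarith
  have h0 := exp_sub_one_pos (τ := t / n) (by positivity)
  have h2 : 1 + s / paretoQuantile s n t = Real.exp (t / n) := by
    rw [paretoQuantile]; field_simp; ring
  simp only [h1, h2, Real.log_exp]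
  field_simp

theorem roundingError_eq (hs : 0 < s) (hn : 1 ≤ n) {t : ℝ} (ht : 0 < t)
    (h : Int.fract (paretoQuantile s n t) ≠ 0) :
    roundingError s n t = 1 / 2 - Int.fract (paretoQuantile s n t) := by
  have h1 := Int.ceil_eq_add_one_sub_fract h
  have h2 : (paretoCeil s n t : ℝ) = ⌈paretoQuantile s n t⌉ :=
    natCast_ceil_eq_intCast_ceil (paretoQuantile_pos hs hn ht).le
  rw [roundingError, h2, h1]; ring

/-- Off a countable set ρ = R'(V) for the bounded periodic primitive R, and V' = -(s/n)/q with q =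
exp(t/n) + exp(-t/n) - 2. So ρ = -(n/s) q (R∘V)', and integration by parts moves the derivative onto
γ(s/t) exp(-t) q. Since that derivative is O(1/n²) with an integrable majorant, the prefactor n
leaves O(1/n). -/
theorem exists_abs_integral_roundingError_le (hs : 0 < s) :
    ∃ C : ℝ, 0 ≤ C ∧ ∀ (γ γ' : ℝ → ℝ) (K : ℝ), 0 ≤ K → Measurable γ → Measurable γ' →
      (∀ u, 0 < u → HasDerivAt γ (γ' u) u) → (∀ u, 0 < u → |γ u| ≤ K / u) →
      (∀ u, 0 < u → |γ' u| ≤ K / u ^ 2) → ∀ n : ℕ, 1 ≤ n →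
      |∫ t in Ioi 0, γ (s / t) * roundingError s n t * Real.exp (-t)| ≤ C * K / n := by
  have hB1 : IntegrableOn (fun t => 1 / s * (t ^ 1 * Real.exp (-(1 * t)))) (Ioi 0) :=
    (integrableOn_pow_mul_exp_neg 1 one_pos).const_mul _
  have hB2 : IntegrableOn (fun t : ℝ => 3 * (t ^ 2 * Real.exp (-(1 / 2 * t)))
      + t ^ 3 * Real.exp (-(1 / 2 * t))) (Ioi 0) :=
    ((integrableOn_pow_mul_exp_neg 2 (by norm_num)).const_mul _).add
      (integrableOn_pow_mul_exp_neg 3 (by norm_num))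
  set C₁ := ∫ t in Ioi (0 : ℝ), 1 / s * (t ^ 1 * Real.exp (-(1 * t))) with hC₁
  set C₂ := ∫ t in Ioi (0 : ℝ), (3 * (t ^ 2 * Real.exp (-(1 / 2 * t)))
      + t ^ 3 * Real.exp (-(1 / 2 * t))) with hC₂
  have hC₁0 : 0 ≤ C₁ := setIntegral_nonneg measurableSet_Ioi fun t ht => by
    have ht : (0 : ℝ) < t := ht
    positivity
  have hC₂0 : 0 ≤ C₂ := setIntegral_nonneg measurableSet_Ioi fun t ht => by
    have ht : (0 : ℝ) < t := ht
    positivity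
  refine ⟨C₁ + C₂ / s ^ 2, by positivity, ?_⟩
  intro γ γ' K hK hγm hγ'm hγ h0 h1 n hn
  have hn' : (0 : ℝ) < n := by exact_mod_cast hn
  have hρm := measurable_roundingError s n
  have hVm := measurable_paretoQuantile s n
  have hγb : ∀ t, 0 < t → |γ (s / t)| ≤ K * t / s := fun t ht =>
    (h0 _ (by positivity)).trans_eq (by field_simp)
  have hγ'b : ∀ t, 0 < t → |γ' (s / t)| ≤ K * t ^ 2 / s ^ 2 := fun t ht =>
    (h1 _ (by positivity)).trans_eq (by field_simp)
  have hpt : ∀ t ∈ Ioi (0 : ℝ), |γ (s / t) * roundingError s n t * Real.exp (-t)|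
      ≤ K * (1 / s * (t ^ 1 * Real.exp (-(1 * t)))) := by
    intro t ht
    have ht : (0 : ℝ) < t := ht
    rw [abs_mul, abs_mul, abs_of_pos (Real.exp_pos _)]
    calc _ ≤ K * t / s * 1 * Real.exp (-t) := by
          gcongr
          · exact hγb t ht
          · linarith [abs_roundingError_le hs hn ht]
      _ = _ := by rw [one_mul t]; ring
  have hi : IntegrableOn (fun t => γ (s / t) * roundingError s n t * Real.exp (-t)) (Ioi 0) :=
    integrableOn_of_abs_le measurableSet_Ioi (hB1.const_mul K)
      (Measurable.aestronglyMeasurable (by fun_prop)) hpt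
  have htriv : |∫ t in Ioi 0, γ (s / t) * roundingError s n t * Real.exp (-t)| ≤ K * C₁ := by
    rw [hC₁, ← integral_const_mul, ← Real.norm_eq_abs]
    exact norm_integral_le_of_norm_le (hB1.const_mul K)
      ((ae_restrict_iff' measurableSet_Ioi).2 (Eventually.of_forall hpt))
  -- For n = 1 the growth exp(t/n) of q cancels exp(-t) completely, so the trivial bound is used.
  -- For n ≥ 2 the decay exp(-t/2) survives.
  rcases hn.eq_or_lt with rfl | hn2
  · refine htriv.trans ?_
    have : 0 ≤ C₂ / s ^ 2 * K := by positivity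
    rw [Nat.cast_one, div_one, add_mul]; linarith
  have hn2' : (2 : ℝ) ≤ n := by exact_mod_cast hn2
  -- integrate by parts against the periodic primitive
  let q : ℝ → ℝ := fun t => Real.exp (t / n) + Real.exp (-(t / n)) - 2
  let χ : ℝ → ℝ := fun t => γ (s / t) * Real.exp (-t) * q t
  let χ' : ℝ → ℝ := fun t => (-(γ' (s / t) * (s / t ^ 2)) * Real.exp (-t)
    - γ (s / t) * Real.exp (-t)) * q t
    + γ (s / t) * Real.exp (-t) * ((Real.exp (t / n) - Real.exp (-(t / n))) / n)
  have hexp : ∀ t, 0 < t → Real.exp (-t) * Real.exp (t / n) ≤ Real.exp (-(1 / 2 * t)) := by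
    intro t ht
    rw [← Real.exp_add, Real.exp_le_exp]
    have : t / n ≤ t / 2 := by gcongr
    linarith
  have hq0 : ∀ t, 0 ≤ q t := fun t => exp_add_exp_neg_sub_two_nonneg _
  have hq1 : ∀ t, 0 < t → q t ≤ (t / n) ^ 2 * Real.exp (t / n) := fun t ht =>
    exp_add_exp_neg_sub_two_le (by positivity)
  have hχ : ∀ t, 0 < t → HasDerivAt χ (χ' t) t := by
    intro t ht
    have e1 := (hγ (s / t) (by positivity)).comp t
      ((hasDerivAt_const t s).div (hasDerivAt_id t) ht.ne')
    have e2 := (hasDerivAt_id t).neg.exp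
    have e3 := ((hasDerivAt_id t).div_const (n : ℝ)).exp
    have e4 := ((hasDerivAt_id t).div_const (n : ℝ)).neg.exp
    refine ((e1.mul e2).mul ((e3.add e4).sub_const 2)).congr_deriv ?_
    simp only [χ', q, Function.comp, Pi.neg_apply, Pi.mul_apply, Pi.add_apply, id]
    ring
  have hχ'b : ∀ t, 0 < t → |χ' t| ≤ K / s / n ^ 2 * (3 * (t ^ 2 * Real.exp (-(1 / 2 * t)))
      + t ^ 3 * Real.exp (-(1 / 2 * t))) := by
    intro t ht
    have hE := hexp t ht
    have b1 : |-(γ' (s / t) * (s / t ^ 2)) * Real.exp (-t) * q t|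
        ≤ K * t ^ 2 / s ^ 2 * (s / t ^ 2) * (Real.exp (-t) * ((t / n) ^ 2 * Real.exp (t / n))) := by
      rw [abs_mul, abs_mul, abs_neg, abs_mul, abs_of_pos (Real.exp_pos _), abs_of_nonneg (hq0 t),
        abs_of_pos (a := s / t ^ 2) (by positivity), mul_assoc]
      gcongr
      · exact mul_nonneg (Real.exp_pos _).le (hq0 t)
      · exact hγ'b t ht
      · exact hq1 t ht
    have b2 : |γ (s / t) * Real.exp (-t) * q t|
        ≤ K * t / s * (Real.exp (-t) * ((t / n) ^ 2 * Real.exp (t / n))) := by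
      rw [abs_mul, abs_mul, abs_of_pos (Real.exp_pos _), abs_of_nonneg (hq0 t), mul_assoc]
      gcongr
      · exact mul_nonneg (Real.exp_pos _).le (hq0 t)
      · exact hγb t ht
      · exact hq1 t ht
    have b3 : |γ (s / t) * Real.exp (-t) * ((Real.exp (t / n) - Real.exp (-(t / n))) / n)|
        ≤ K * t / s * (Real.exp (-t) * (2 * (t / n) * Real.exp (t / n) / n)) := by
      rw [abs_mul, abs_mul, abs_of_pos (Real.exp_pos _), abs_div, abs_of_pos hn', mul_assoc]
      gcongr
      · exact hγb t ht
      · exact abs_exp_sub_exp_neg_le (by positivity)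
    have hsplit : χ' t = -(γ' (s / t) * (s / t ^ 2)) * Real.exp (-t) * q t
        - γ (s / t) * Real.exp (-t) * q t
        + γ (s / t) * Real.exp (-t) * ((Real.exp (t / n) - Real.exp (-(t / n))) / n) := by
      simp only [χ']; ring
    rw [hsplit]
    refine (abs_add_le _ _).trans ((add_le_add ((abs_sub _ _).trans (add_le_add b1 b2)) b3).trans ?_)
    calc _ = K / s / n ^ 2 * (3 * (t ^ 2 * (Real.exp (-t) * Real.exp (t / n)))
          + t ^ 3 * (Real.exp (-t) * Real.exp (t / n))) := by field_simp; ring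
      _ ≤ _ := by gcongr
  have hR := continuous_sawtoothPrimitive
  have hRm := hR.measurable
  have hχ'm : Measurable χ' := by simp only [χ', q]; fun_prop
  have hi1b : ∀ t ∈ Ioi (0 : ℝ), |χ' t * sawtoothPrimitive (paretoQuantile s n t)|
      ≤ K / s / n ^ 2 * (3 * (t ^ 2 * Real.exp (-(1 / 2 * t)))
      + t ^ 3 * Real.exp (-(1 / 2 * t))) := by
    intro t ht
    rw [abs_mul]
    calc _ ≤ |χ' t| * 1 := by gcongr; exact abs_sawtoothPrimitive_le _
      _ ≤ _ := by rw [mul_one]; exact hχ'b t ht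
  have hi1 : IntegrableOn (fun t => χ' t * sawtoothPrimitive (paretoQuantile s n t)) (Ioi 0) :=
    integrableOn_of_abs_le measurableSet_Ioi (hB2.const_mul (K / s / n ^ 2))
      (Measurable.aestronglyMeasurable (by fun_prop)) hi1b
  have hχb : ∀ t, 0 < t → |χ t * sawtoothPrimitive (paretoQuantile s n t)|
      ≤ K / s / n ^ 2 * (t ^ 3 * Real.exp (-(1 / 2 * t))) := by
    intro t ht
    rw [abs_mul, abs_mul, abs_mul, abs_of_pos (Real.exp_pos _), abs_of_nonneg (hq0 t)]
    calc _ ≤ K * t / s * Real.exp (-t) * ((t / n) ^ 2 * Real.exp (t / n)) * 1 := by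
          gcongr
          · exact hq0 t
          · exact hγb t ht
          · exact hq1 t ht
          · exact abs_sawtoothPrimitive_le _
      _ = K / s / n ^ 2 * (t ^ 3 * (Real.exp (-t) * Real.exp (t / n))) := by field_simp
      _ ≤ _ := by gcongr; exact hexp t ht
  obtain ⟨S, hS, hSV⟩ := countable_paretoQuantile_integer hs hn
  have hbc : Continuous fun t : ℝ => K / s / n ^ 2 * (t ^ 3 * Real.exp (-(1 / 2 * t))) := by
    fun_prop
  have key := integral_Ioi_zero_of_hasDerivAt_off_countable (a := 0) (b := 0)
    (f := fun t => χ t * sawtoothPrimitive (paretoQuantile s n t))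
    (f' := fun t => χ' t * sawtoothPrimitive (paretoQuantile s n t)
      - s / n * (γ (s / t) * roundingError s n t * Real.exp (-t))) hS
    (fun t ht => ((hχ t ht).continuousAt.mul (hR.continuousAt.comp
      (hasDerivAt_paretoQuantile hn ht).continuousAt)).continuousWithinAt)
    (fun t ht => by
      have ht0 : (0 : ℝ) < t := ht.1
      have hf := hSV t ht
      refine ((hχ t ht0).mul ((hasDerivAt_sawtoothPrimitive hf).comp t
        (hasDerivAt_paretoQuantile hn ht0))).congr_deriv ?_
      rw [roundingError_eq hs hn ht0 hf]
      have hq : 0 < q t := by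
        simp only [q]
        rw [exp_add_exp_neg_sub_two]
        have := exp_sub_one_pos (τ := t / n) (by positivity)
        positivity
      simp only [Function.comp, χ]
      change _ + _ * q t * (_ * (_ / q t)) = _
      field_simp
      ring)
    (hi1.sub (hi.const_mul _))
    (by
      refine squeeze_zero_norm' (by
        filter_upwards [self_mem_nhdsWithin] with t ht using hχb t ht) ?_
      simpa using (hbc.tendsto 0).mono_left (nhdsWithin_le_nhds (s := Ioi 0)))
    (by
      refine squeeze_zero_norm' (by
        filter_upwards [Ioi_mem_atTop (0 : ℝ)] with t ht using hχb t ht) ?_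
      have h1 := (tendsto_rpow_mul_exp_neg_mul_atTop_nhds_zero 3 (1 / 2) (by norm_num)).const_mul
        (K / s / n ^ 2)
      rw [mul_zero] at h1
      refine h1.congr fun t => ?_
      rw [show (3 : ℝ) = ((3 : ℕ) : ℝ) by norm_num, Real.rpow_natCast, neg_mul])
  rw [integral_sub hi1 (hi.const_mul _), integral_const_mul, sub_self, sub_eq_zero] at key
  have hb : |∫ t in Ioi 0, χ' t * sawtoothPrimitive (paretoQuantile s n t)|
      ≤ K / s / n ^ 2 * C₂ := by
    rw [hC₂, ← integral_const_mul, ← Real.norm_eq_abs]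
    exact norm_integral_le_of_norm_le (hB2.const_mul _)
      ((ae_restrict_iff' measurableSet_Ioi).2 (Eventually.of_forall hi1b))
  rw [key, abs_mul, abs_of_pos (by positivity), ← le_div_iff₀' (by positivity)] at hb
  refine hb.trans ?_
  have : 0 ≤ C₁ * K / n := by positivity
  calc _ = C₂ / s ^ 2 * K / n := by field_simp
    _ ≤ _ := by rw [add_mul, add_div]; linarith

/-- In a second order Taylor expansion about s/t, the increment N/n - s/t is replaced by (ρ +
(1-s)/2)/n. The part with ρ is negligible by the averaging estimate applied to γ = g'. -/
theorem exists_abs_integral_paretoCeil_second_order_le (hs : 0 < s) :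
    ∃ C : ℝ, 0 ≤ C ∧ ∀ (g g' g'' : ℝ → ℝ) (K : ℝ), 0 ≤ K → Measurable g → Measurable g' →
      Measurable g'' → (∀ u, 0 < u → HasDerivAt g (g' u) u) →
      (∀ u, 0 < u → HasDerivAt g' (g'' u) u) → (∀ u, 0 < u → |g u| ≤ K) →
      (∀ u, 0 < u → |g' u| ≤ K / u) → (∀ u, 0 < u → |g'' u| ≤ K / u ^ 2) →
      ∀ n : ℕ, 1 ≤ n →
      |(∫ t in Ioi 0, g ((paretoCeil s n t : ℝ) / n) * Real.exp (-t))
          - (∫ t in Ioi 0, g (s / t) * Real.exp (-t))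
          - (1 - s) / (2 * n) * ∫ t in Ioi 0, g' (s / t) * Real.exp (-t)| ≤ C * K / n ^ 2 := by
  obtain ⟨C₀, hC₀, H⟩ := exists_abs_integral_roundingError_le hs
  set κ := 1 + 2 / s with hκ
  have hκ0 : 0 < κ := by positivity
  have hB : IntegrableOn (fun t : ℝ => (κ ^ 2 * (1 + s) ^ 2 + 2) *
      (t ^ 2 * Real.exp (-(1 * t)))) (Ioi 0) :=
    (integrableOn_pow_mul_exp_neg 2 one_pos).const_mul _
  set C₁ := ∫ t in Ioi (0 : ℝ), (κ ^ 2 * (1 + s) ^ 2 + 2) * (t ^ 2 * Real.exp (-(1 * t)))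
  have hC₁ : 0 ≤ C₁ := setIntegral_nonneg measurableSet_Ioi fun t _ => by positivity
  refine ⟨C₁ + C₀, by positivity, ?_⟩
  intro g g' g'' K hK hgm hg'm hg''m hg hg' h0 h1 h2 n hn
  have hn' : (0 : ℝ) < n := by exact_mod_cast hn
  have hρm := measurable_roundingError s n
  have hρ := H g' g'' K hK hg'm hg''m hg' h1 h2 n hn
  have h0' : ∀ u, 0 < u → |g u| ≤ K * (1 + 1 / u) := fun u hu => (h0 u hu).trans (by
    have : 0 ≤ K * (1 / u) := by positivity
    linarith)
  have h1' : ∀ u, 0 < u → |g' u| ≤ K * (1 + 1 / u) := fun u hu => (h1 u hu).trans (by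
    have : K * (1 / u) = K / u := by ring
    linarith)
  have i1 := integrableOn_comp_paretoCeil hgm hs hn hK h0'
  have i2 := integrableOn_comp_div hgm hs h0'
  have i3 := (integrableOn_comp_div hg'm hs h1').const_mul ((1 - s) / (2 * n))
  have i4 : IntegrableOn (fun t => 1 / (n : ℝ) * (g' (s / t) * roundingError s n t
      * Real.exp (-t))) (Ioi 0) := by
    refine Integrable.const_mul (Integrable.mono (integrableOn_comp_div hg'm hs h1')
      (Measurable.aestronglyMeasurable (by fun_prop))
      ((ae_restrict_iff' measurableSet_Ioi).2 (Eventually.of_forall fun t ht => ?_))) _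
    rw [Real.norm_eq_abs, Real.norm_eq_abs, abs_mul, abs_mul, abs_mul]
    have := abs_roundingError_le hs hn ht
    gcongr
    exact mul_le_of_le_one_right (abs_nonneg _) (by linarith)
  have hpt : ∀ t ∈ Ioi (0 : ℝ), ‖g ((paretoCeil s n t : ℝ) / n) * Real.exp (-t)
      - g (s / t) * Real.exp (-t) - (1 - s) / (2 * n) * (g' (s / t) * Real.exp (-t))
      - 1 / n * (g' (s / t) * roundingError s n t * Real.exp (-t))‖
      ≤ K / n ^ 2 * ((κ ^ 2 * (1 + s) ^ 2 + 2) * (t ^ 2 * Real.exp (-(1 * t)))) := by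
    intro t ht
    have ht : (0 : ℝ) < t := ht
    have hpos : 0 < 1 / (κ * t) := by positivity
    have e1 := abs_sub_sub_mul_le_of_hasDerivAt (M := K * (κ * t) ^ 2)
      (one_div_le_div hs ht) (one_div_le_paretoCeil_div hs hn ht)
      (fun w hw => hg w (hpos.trans_le hw)) (fun w hw => hg' w (hpos.trans_le hw))
      (fun w hw => (h2 w (hpos.trans_le hw)).trans (by
        have : 1 / w ≤ κ * t := by
          have := one_div_le_one_div_of_le hpos hw
          rwa [one_div_one_div] at this
        have hw0 : 0 < 1 / w := one_div_pos.2 (hpos.trans_le hw)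
        rw [div_eq_mul_one_div, ← one_div_pow]
        gcongr))
    have e2 := abs_paretoCeil_div_sub_le hs hn ht
    have e3 := abs_paretoCeil_div_sub_sub_le hs hn ht
    have e4 : |g' (s / t)| ≤ K * t / s := (h1 _ (by positivity)).trans_eq (by field_simp)
    set N : ℝ := (paretoCeil s n t : ℝ) / n
    set ρ := roundingError s n t
    have hsplit : g N * Real.exp (-t) - g (s / t) * Real.exp (-t)
        - (1 - s) / (2 * n) * (g' (s / t) * Real.exp (-t))
        - 1 / n * (g' (s / t) * ρ * Real.exp (-t))
        = ((g N - g (s / t) - g' (s / t) * (N - s / t))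
          + g' (s / t) * (N - s / t - (ρ + (1 - s) / 2) / n)) * Real.exp (-t) := by
      field_simp; ring
    rw [hsplit, Real.norm_eq_abs, abs_mul, abs_of_pos (Real.exp_pos _)]
    calc _ ≤ (K * (κ * t) ^ 2 * ((1 + s) / n) ^ 2 + K * t / s * (2 * s * t / n ^ 2))
            * Real.exp (-t) := by
          gcongr
          refine (abs_add_le _ _).trans (add_le_add (e1.trans ?_) ?_)
          · gcongr
          · rw [abs_mul]; gcongr
      _ = _ := by rw [one_mul]; field_simp
  have i12 : IntegrableOn (fun t => g ((paretoCeil s n t : ℝ) / n) * Real.exp (-t)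
      - g (s / t) * Real.exp (-t)) (Ioi 0) := i1.sub i2
  have i123 : IntegrableOn (fun t => g ((paretoCeil s n t : ℝ) / n) * Real.exp (-t)
      - g (s / t) * Real.exp (-t) - (1 - s) / (2 * n) * (g' (s / t) * Real.exp (-t))) (Ioi 0) :=
    i12.sub i3
  have hmain := norm_integral_le_of_norm_le (hB.const_mul (K / n ^ 2))
    ((ae_restrict_iff' measurableSet_Ioi).2 (Eventually.of_forall hpt))
  rw [integral_sub i123 i4, integral_sub i12 i3, integral_sub i1 i2,
    integral_const_mul, integral_const_mul, integral_const_mul, Real.norm_eq_abs] at hmain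
  have hρ' : |1 / (n : ℝ) * ∫ t in Ioi 0, g' (s / t) * roundingError s n t * Real.exp (-t)|
      ≤ C₀ * K / n ^ 2 := by
    rw [abs_mul, abs_of_pos (by positivity)]
    calc _ ≤ 1 / (n : ℝ) * (C₀ * K / n) := by gcongr
      _ = _ := by field_simp
  have hfin : ∀ a b A B : ℝ, |a - b| ≤ A → |b| ≤ B → |a| ≤ A + B := fun a b A B ha hb => by
    have := abs_add_le (a - b) b
    rw [sub_add_cancel] at this
    linarith
  refine (hfin _ _ _ _ hmain hρ').trans_eq ?_
  ring

end Rounding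


/-! ### Measurability of the sample median -/

theorem measurable_orderStat (m k : ℕ) : Measurable fun x : ℕ → ℝ => orderStat x m k := by
  unfold orderStat
  split_ifs with h
  swap
  · exact measurable_const
  refine measurable_of_Iic fun a => ?_
  -- The sorted entry of index k - 1 is at most a exactly when more than k - 1 observations are;
  -- this count does not depend on the sorting permutation and is measurable.
  have hset : (fun x : ℕ → ℝ => (fun i : Fin m => x i)
      (Tuple.sort (fun i : Fin m => x i) ⟨k - 1, by omega⟩)) ⁻¹' Iic a
      = {x : ℕ → ℝ | k - 1 < ∑ i : Fin m, if x i ≤ a then 1 else 0} := by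
    ext x
    have h1 := Tuple.lt_card_le_iff_apply_le_of_monotone (j := ⟨k - 1, by omega⟩) (a := a)
      (Tuple.monotone_sort (fun i : Fin m => x i))
    rw [Finset.card_filter] at h1
    have h2 := Equiv.sum_comp (Tuple.sort fun i : Fin m => x i)
      (fun i : Fin m => if x i ≤ a then 1 else 0)
    simp only [Function.comp] at h1
    rw [h2] at h1
    exact h1.symm
  rw [hset]
  refine measurableSet_lt measurable_const (Finset.measurable_sum _ fun i _ => ?_)
  exact Measurable.ite (measurableSet_le (measurable_pi_apply _) measurable_const)
    measurable_const measurable_const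

theorem measurable_sampleMedian (m : ℕ) : Measurable fun x : ℕ → ℝ => sampleMedian x m := by
  unfold sampleMedian
  split_ifs
  · exact measurable_orderStat _ _
  · exact ((measurable_orderStat _ _).add (measurable_orderStat _ _)).div_const 2

/-! ### The law of the random sample size -/

variable {Ω : Type*} [MeasurableSpace Ω] {P : Measure Ω}

theorem aemeasurable_sampleSize {Y : ℕ → Ω → ℕ} (hY : ∀ j, AEMeasurable (Y j) P) (n : ℕ) :
    AEMeasurable (sampleSize Y n) P := by
  induction n with
  | zero =>
    have : sampleSize Y 0 = fun _ => 0 := by ext; simp [sampleSize]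
    rw [this]; exact aemeasurable_const
  | succ n ih =>
    have : sampleSize Y (n + 1) = fun ω => Y n ω ⊔ sampleSize Y n ω := by
      ext ω; simp [sampleSize, Finset.range_add_one]
    rw [this]; exact (hY n).sup ih

theorem IsDiscreteParetoSample.real_le [IsProbabilityMeasure P] {s : ℝ} (hs : 0 < s)
    {Y : ℕ → Ω → ℕ} (hY : IsDiscreteParetoSample s Y P) (j m : ℕ) :
    P.real (Y j ⁻¹' Iic m) = m / (s + m) := by
  have hYm := hY.aemeasurable j
  set ν := P.map (Y j) with hν
  have : IsProbabilityMeasure ν := Measure.isProbabilityMeasure_map hYm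
  have hνs : ∀ S : Set ℕ, ν.real S = P.real (Y j ⁻¹' S) := fun S =>
    map_measureReal_apply_of_aemeasurable hYm S.to_countable.measurableSet
  have hpmf : ∀ k : ℕ, 1 ≤ k → ν.real {k} = s / (s + k - 1) - s / (s + k) := fun k hk => by
    rw [hνs]; exact hY.pmf j k hk
  have hcdf : ∀ m : ℕ, ν.real (Iic m) = ν.real {0} + (1 - s / (s + m)) := by
    intro m
    induction m with
    | zero =>
      have : Iic 0 = ({0} : Set ℕ) := by ext; simp
      rw [this]; simp [hs.ne']
    | succ m ih =>
      have hu : Iic (m + 1) = Iic m ∪ {m + 1} := by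
        ext i
        simp only [mem_Iic, mem_union, mem_singleton_iff]
        omega
      rw [hu, measureReal_union (by simp) (by simp), ih, hpmf (m + 1) (by omega)]
      push_cast
      ring
  -- The masses at 1, …, m telescope to 1 - s/(s+m). As total mass cannot exceed 1, letting m grow
  -- leaves nothing for the point 0.
  have h0 : ν.real {0} = 0 := by
    refine le_antisymm (le_of_forall_pos_le_add fun ε hε => ?_) measureReal_nonneg
    obtain ⟨m, hm⟩ := exists_nat_gt (s / ε)
    have h1 : ν.real (Iic m) ≤ 1 := measureReal_le_one
    have h2 : s / (s + m) ≤ ε := by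
      rw [div_lt_iff₀ hε] at hm
      rw [div_le_iff₀ (by positivity)]
      nlinarith
    rw [hcdf] at h1
    linarith
  have h := hcdf m
  rw [h0, hνs] at h
  rw [h]
  have : s + m ≠ 0 := by positivity
  field_simp
  ring

/-- The standard exponential distribution. -/
noncomputable def expLaw : Measure ℝ :=
  (volume.restrict (Ioi 0)).withDensity fun t => ENNReal.ofReal (Real.exp (-t))

theorem expLaw_apply {S : Set ℝ} (hS : MeasurableSet S) :
    expLaw S = ENNReal.ofReal (∫ t in S ∩ Ioi 0, Real.exp (-t)) := by
  rw [expLaw, withDensity_apply _ hS, Measure.restrict_restrict hS,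
    ofReal_integral_eq_lintegral_ofReal]
  · exact integrableOn_exp_neg.mono_set inter_subset_right
  · exact Eventually.of_forall fun t => (Real.exp_pos _).le

theorem integral_expLaw (f : ℝ → ℝ) :
    ∫ t, f t ∂expLaw = ∫ t in Ioi 0, f t * Real.exp (-t) := by
  rw [expLaw, integral_withDensity_eq_integral_toReal_smul (by fun_prop) (by simp)]
  congr 1; ext t
  rw [ENNReal.toReal_ofReal (Real.exp_pos _).le, smul_eq_mul, mul_comm]

theorem map_sampleSize_eq [IsProbabilityMeasure P] {s : ℝ} (hs : 0 < s) {Y : ℕ → Ω → ℕ}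
    (hY : IsDiscreteParetoSample s Y P) {n : ℕ} (hn : 1 ≤ n) :
    P.map (sampleSize Y n) = expLaw.map (paretoCeil s n) := by
  have hn' : (0 : ℝ) < n := by exact_mod_cast hn
  have hNm := aemeasurable_sampleSize hY.aemeasurable n
  have : IsProbabilityMeasure (P.map (sampleSize Y n)) := Measure.isProbabilityMeasure_map hNm
  refine Measure.ext_of_Iic _ _ fun m => ?_
  rw [Measure.map_apply_of_aemeasurable hNm measurableSet_Iic,
    Measure.map_apply (measurable_paretoCeil s n) measurableSet_Iic,
    expLaw_apply (measurable_paretoCeil s n measurableSet_Iic)]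
  have hL : P (sampleSize Y n ⁻¹' Iic m) = ENNReal.ofReal ((m / (s + m)) ^ n) := by
    have h1 : sampleSize Y n ⁻¹' Iic m = ⋂ j ∈ Finset.range n, Y j ⁻¹' Iic m := by
      ext ω; simp [sampleSize, Finset.sup_le_iff]
    rw [h1, hY.indep.measure_inter_preimage_eq_mul (Finset.range n)
      (fun _ _ => measurableSet_Iic)]
    have h2 : ∀ j ∈ Finset.range n, P (Y j ⁻¹' Iic m) = ENNReal.ofReal (m / (s + m)) := by
      intro j _
      rw [← hY.real_le hs j m, ofReal_measureReal]
    rw [Finset.prod_congr rfl h2, Finset.prod_const, Finset.card_range,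
      ENNReal.ofReal_pow (by positivity)]
  rw [hL]
  congr 1
  -- For m = 0 the convention s/0 = 0 would turn the threshold n log(1 + s/m) into 0 instead of +∞.
  rcases Nat.eq_zero_or_pos m with rfl | hm
  · have : paretoCeil s n ⁻¹' Iic 0 ∩ Ioi 0 = ∅ := by
      ext t
      simp only [mem_inter_iff, mem_preimage, mem_Iic, mem_Ioi, mem_empty_iff_false, iff_false,
        not_and, not_lt]
      intro h
      by_contra ht
      have := one_le_paretoCeil hs hn (not_le.1 ht)
      omega
    rw [this]
    simp; omega
  have hm' : (0 : ℝ) < m := by exact_mod_cast hm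
  have hlog : 0 < Real.log (1 + s / m) :=
    Real.log_pos (by have : 0 < s / m := by positivity
                     linarith)
  have hset : paretoCeil s n ⁻¹' Iic m ∩ Ioi 0 = Ici (n * Real.log (1 + s / m)) := by
    ext t
    simp only [mem_inter_iff, mem_preimage, mem_Iic, mem_Ioi, mem_Ici]
    have key : ∀ ht : 0 < t, paretoCeil s n t ≤ m ↔ n * Real.log (1 + s / m) ≤ t := by
      intro ht
      have h0 := exp_sub_one_pos (τ := t / n) (by positivity)
      rw [paretoCeil, Nat.ceil_le, paretoQuantile, div_le_iff₀ h0, ← div_le_iff₀' hm',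
        le_sub_iff_add_le', ← Real.log_le_iff_le_exp (by positivity), le_div_iff₀' hn']
    constructor
    · rintro ⟨h1, h2⟩
      exact (key h2).1 h1
    · intro h
      have ht : 0 < t := lt_of_lt_of_le (by positivity) h
      exact ⟨(key ht).2 h, ht⟩
  rw [hset, integral_Ici_eq_integral_Ioi, integral_exp_neg_Ioi, ← mul_neg, Real.exp_nat_mul,
    Real.exp_neg, Real.exp_log (by positivity)]
  congr 1
  field_simp
  ring

theorem integral_map_sampleSize [IsProbabilityMeasure P] {s : ℝ} (hs : 0 < s) {Y : ℕ → Ω → ℕ}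
    (hY : IsDiscreteParetoSample s Y P) {n : ℕ} (hn : 1 ≤ n) (a : ℕ → ℝ) :
    ∫ m, a m ∂(P.map (sampleSize Y n)) = ∫ t in Ioi 0, a (paretoCeil s n t) * Real.exp (-t) := by
  rw [map_sampleSize_eq hs hY hn, integral_map (measurable_paretoCeil s n).aemeasurable
    (measurable_from_nat.aestronglyMeasurable), integral_expLaw]

/-! ### Conditioning on the sample size -/

/-- The distribution function of the normalized median of a sample of fixed size `m`. -/
noncomputable def fixedSizeCdf (p₀ θ : ℝ) (X : ℕ → Ω → ℝ) (P : Measure Ω) (n : ℕ) (x : ℝ)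
    (m : ℕ) : ℝ :=
  P.real {ω | normalizedMedian p₀ θ X n (fun _ => m) ω ≤ x}

/-- The event splits over the countably many values of `N`, and independence factors each piece. -/
theorem real_normalizedMedian_eq_integral [IsProbabilityMeasure P] {p₀ θ : ℝ} {X : ℕ → Ω → ℝ}
    (hX : ∀ i, AEMeasurable (X i) P) {N : Ω → ℕ} (hN : AEMeasurable N P)
    (hind : IndepFun (fun ω i => X i ω) N P) (n : ℕ) (x : ℝ) :
    P.real {ω | normalizedMedian p₀ θ X n N ω ≤ x}
      = ∫ m, fixedSizeCdf p₀ θ X P n x m ∂(P.map N) := by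
  let T : ℕ → Set (ℕ → ℝ) := fun m =>
    {y | 2 * p₀ * √((n : ℝ) * (evenPart m : ℝ) / (m : ℝ)) * (sampleMedian y m - θ) ≤ x}
  have hT : ∀ m, MeasurableSet (T m) := fun m =>
    measurableSet_le (((measurable_sampleMedian m).sub_const θ).const_mul _) measurable_const
  let X' : Ω → ℕ → ℝ := fun ω i => X i ω
  have hX' : AEMeasurable X' P := aemeasurable_pi_iff.2 hX
  have hunion : {ω | normalizedMedian p₀ θ X n N ω ≤ x}
      = ⋃ m, X' ⁻¹' (T m) ∩ N ⁻¹' {m} := by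
    ext ω
    simp [T, X', normalizedMedian]
  have hdisj : Pairwise (Function.onFun (AEDisjoint P) fun m => X' ⁻¹' (T m) ∩ N ⁻¹' {m}) := by
    intro i j hij
    refine Disjoint.aedisjoint (Set.disjoint_left.2 fun ω h1 h2 => hij ?_)
    exact h1.2.symm.trans h2.2
  have hmeas : ∀ m, NullMeasurableSet (X' ⁻¹' (T m) ∩ N ⁻¹' {m}) P := fun m =>
    (hX'.nullMeasurableSet_preimage (hT m)).inter
      (hN.nullMeasurableSet_preimage (measurableSet_singleton m))
  have hmap : IsProbabilityMeasure (P.map N) := Measure.isProbabilityMeasure_map hN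
  have hmain : P {ω | normalizedMedian p₀ θ X n N ω ≤ x}
      = ∫⁻ m, P (X' ⁻¹' (T m)) ∂(P.map N) := by
    rw [hunion, measure_iUnion₀ hdisj hmeas, lintegral_countable']
    congr 1; ext m
    rw [hind.measure_inter_preimage_eq_mul _ _ (hT m) (measurableSet_singleton m),
      Measure.map_apply_of_aemeasurable hN (measurableSet_singleton m)]
  rw [measureReal_def, hmain, ← integral_toReal (measurable_from_nat.aemeasurable)
    (Eventually.of_forall fun m => measure_lt_top _ _)]
  rfl


/-! ### Expansion of the mixture -/

section Expansion

variable {s : ℝ}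

theorem measurable_gaussMonomial (k : ℕ) (x : ℝ) : Measurable (gaussMonomial k x) :=
  (continuous_gaussMonomial k x).measurable

/-- The second expression is the numerator of the derivative of the monomial divided by u^c. It is
used with c = 1 and c = 1/2. -/
theorem exists_abs_deriv_gaussMonomial_le (k : ℕ) :
    ∃ K : ℝ, 0 ≤ K ∧ ∀ c x u : ℝ, |c| ≤ 1 →
      |gaussMonomial k x u| ≤ K ∧
      |(k * gaussMonomial k x u - gaussMonomial (k + 2) x u) / 2 - c * gaussMonomial k x u|
        ≤ K := by
  obtain ⟨K₁, hK₁, h₁⟩ := exists_gaussMonomial_le k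
  obtain ⟨K₂, hK₂, h₂⟩ := exists_gaussMonomial_le (k + 2)
  refine ⟨(k * K₁ + K₂) / 2 + K₁, by positivity, fun c x u hc => ⟨(h₁ x u).trans ?_, ?_⟩⟩
  · have : 0 ≤ (k * K₁ + K₂) / 2 := by positivity
    linarith
  · refine (abs_sub _ _).trans (add_le_add ?_ ?_)
    · rw [abs_div, abs_of_pos (zero_lt_two' ℝ)]
      gcongr
      refine (abs_sub _ _).trans (add_le_add ?_ (h₂ x u))
      rw [abs_mul, Nat.abs_cast]
      gcongr
      exact h₁ x u
    · rw [abs_mul]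
      exact (mul_le_of_le_one_left (abs_nonneg _) hc).trans (h₁ x u)

theorem exists_abs_integral_gaussMonomial_div_le (hs : 0 < s) (k : ℕ) :
    ∃ C : ℝ, 0 ≤ C ∧ ∀ (x : ℝ) (n : ℕ), 1 ≤ n →
      IntegrableOn (fun t => gaussMonomial k x ((paretoCeil s n t : ℝ) / n)
        / ((paretoCeil s n t : ℝ) / n) * Real.exp (-t)) (Ioi 0) ∧
      |(∫ t in Ioi 0, gaussMonomial k x ((paretoCeil s n t : ℝ) / n)
          / ((paretoCeil s n t : ℝ) / n) * Real.exp (-t))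
        - ∫ t in Ioi 0, gaussMonomial k x (s / t) / (s / t) * Real.exp (-t)| ≤ C / n := by
  obtain ⟨C, hC, H⟩ := exists_abs_integral_paretoCeil_sub_le hs
  obtain ⟨K, hK, hb⟩ := exists_abs_deriv_gaussMonomial_le k
  refine ⟨C * K, by positivity, fun x n hn => ?_⟩
  have hm := measurable_gaussMonomial k x
  have hm' : Measurable fun u => gaussMonomial k x u / u := by fun_prop
  have h0 : ∀ u, 0 < u → |gaussMonomial k x u / u| ≤ K * (1 + 1 / u) := by
    intro u hu
    rw [abs_div, abs_of_pos hu]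
    calc _ ≤ K / u := by gcongr; exact (hb 1 x u (by simp)).1
      _ ≤ _ := by rw [mul_add, mul_one_div]; linarith
  refine ⟨integrableOn_comp_paretoCeil hm' hs hn hK h0,
    H _ (fun u => ((k * gaussMonomial k x u - gaussMonomial (k + 2) x u) / 2
      - 1 * gaussMonomial k x u) / u ^ 2) K hK hm' (fun u hu => ?_) h0 (fun u hu => ?_) n hn⟩
  · refine ((hasDerivAt_gaussMonomial k x hu).div (hasDerivAt_id u) hu.ne').congr_deriv ?_
    simp only [id]
    field_simp
  · rw [abs_div, abs_of_pos (a := u ^ 2) (by positivity)]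
    calc _ ≤ K / u ^ 2 := by gcongr; exact (hb 1 x u (by simp)).2
      _ ≤ _ := by rw [mul_add, mul_one_div]; linarith

theorem exists_abs_integral_gaussMonomial_div_sqrt_le (hs : 0 < s) (k : ℕ) :
    ∃ C : ℝ, 0 ≤ C ∧ ∀ (x : ℝ) (n : ℕ), 1 ≤ n →
      IntegrableOn (fun t => gaussMonomial k x ((paretoCeil s n t : ℝ) / n)
        / √((paretoCeil s n t : ℝ) / n) * Real.exp (-t)) (Ioi 0) ∧
      |(∫ t in Ioi 0, gaussMonomial k x ((paretoCeil s n t : ℝ) / n)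
          / √((paretoCeil s n t : ℝ) / n) * Real.exp (-t))
        - ∫ t in Ioi 0, gaussMonomial k x (s / t) / √(s / t) * Real.exp (-t)| ≤ C / n := by
  obtain ⟨C, hC, H⟩ := exists_abs_integral_paretoCeil_sub_le hs
  obtain ⟨K, hK, hb⟩ := exists_abs_deriv_gaussMonomial_le k
  refine ⟨C * K, by positivity, fun x n hn => ?_⟩
  have hm := measurable_gaussMonomial k x
  have hm' : Measurable fun u => gaussMonomial k x u / √u := by fun_prop
  have hv : ∀ u, 0 < u → 1 / √u ≤ 1 + 1 / u := by
    intro u hu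
    have h1 : 1 / u = (1 / √u) ^ 2 := by rw [one_div_pow, Real.sq_sqrt hu.le]
    rw [h1]
    nlinarith [sq_nonneg (1 / √u - 1)]
  have h0 : ∀ u, 0 < u → |gaussMonomial k x u / √u| ≤ K * (1 + 1 / u) := by
    intro u hu
    rw [abs_div, abs_of_pos (Real.sqrt_pos.2 hu), div_eq_mul_one_div]
    gcongr
    · exact (hb 1 x u (by simp)).1
    · exact hv u hu
  refine ⟨integrableOn_comp_paretoCeil hm' hs hn hK h0,
    H _ (fun u => ((k * gaussMonomial k x u - gaussMonomial (k + 2) x u) / 2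
      - 1 / 2 * gaussMonomial k x u) / (u * √u)) K hK hm' (fun u hu => ?_) h0
      (fun u hu => ?_) n hn⟩
  · have hsu : √u ≠ 0 := (Real.sqrt_pos.2 hu).ne'
    have hq := Real.sq_sqrt hu.le
    refine ((hasDerivAt_gaussMonomial k x hu).div (Real.hasDerivAt_sqrt hu.ne') hsu).congr_deriv ?_
    field_simp
    rw [hq]
    field_simp
  · have hsu : 0 < √u := Real.sqrt_pos.2 hu
    have h1 : 1 / u ^ 2 = (1 / √u) ^ 4 := by
      rw [one_div_pow, show √u ^ 4 = (√u ^ 2) ^ 2 by ring, Real.sq_sqrt hu.le]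
    have h2 : 1 / (u * √u) = (1 / √u) ^ 3 := by
      rw [one_div_pow, show √u ^ 3 = √u ^ 2 * √u by ring, Real.sq_sqrt hu.le]
    rw [abs_div, abs_of_pos (a := u * √u) (by positivity), div_eq_mul_one_div, h1, h2]
    gcongr
    · exact (hb (1 / 2) x u (by rw [abs_of_pos] <;> norm_num)).2
    · have hw : 0 < 1 / √u := by positivity
      set w := 1 / √u
      -- With w = u^(-1/2) the claim is w³ ≤ 1 + w⁴.
      nlinarith [sq_nonneg (w ^ 2 - w), sq_nonneg (w - 1), sq_nonneg (w ^ 2 - 1)]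

theorem exists_abs_integral_stdNormalCdf_le (hs : 0 < s) :
    ∃ C : ℝ, 0 ≤ C ∧ ∀ (x : ℝ) (n : ℕ), 1 ≤ n →
      IntegrableOn (fun t => stdNormalCdf (x * √((paretoCeil s n t : ℝ) / n))
        * Real.exp (-t)) (Ioi 0) ∧
      |(∫ t in Ioi 0, stdNormalCdf (x * √((paretoCeil s n t : ℝ) / n)) * Real.exp (-t))
        - laplaceCdf (1 / √s) x - (1 - s) / (4 * n) * (laplaceDensity (1 / √s) x
          * (x * (1 + √(2 * s) * |x|) / (2 * s)))| ≤ C / n ^ 2 := by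
  obtain ⟨C, hC, H⟩ := exists_abs_integral_paretoCeil_second_order_le hs
  obtain ⟨K, hK, hb⟩ := exists_abs_deriv_gaussMonomial_le 1
  refine ⟨C * (K + 1), by positivity, fun x n hn => ?_⟩
  have hn' : (0 : ℝ) < n := by exact_mod_cast hn
  have hm := measurable_gaussMonomial 1 x
  have hm3 := measurable_gaussMonomial (1 + 2) x
  have hΦ := continuous_stdNormalCdf.measurable
  have hΦm : Measurable fun u => stdNormalCdf (x * √u) := by fun_prop
  have h0 : ∀ u, 0 < u → |stdNormalCdf (x * √u)| ≤ K + 1 := fun u _ =>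
    (abs_stdNormalCdf_le _).trans (by linarith)
  have h := H (fun u => stdNormalCdf (x * √u)) (fun u => gaussMonomial 1 x u / (2 * u))
    (fun u => (((1 : ℕ) * gaussMonomial 1 x u - gaussMonomial (1 + 2) x u) / 2
      - 1 * gaussMonomial 1 x u) / (2 * u ^ 2)) (K + 1) (by linarith) hΦm (by fun_prop)
    (by fun_prop) (fun u hu => hasDerivAt_stdNormalCdf_mul_sqrt x hu) (fun u hu => ?_) h0
    (fun u hu => ?_) (fun u hu => ?_) n hn
  · refine ⟨integrableOn_comp_paretoCeil (K := K + 1) hΦm hs hn (by linarith)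
      fun u hu => (h0 u hu).trans ?_, ?_⟩
    · have : 0 ≤ (K + 1) * (1 / u) := by positivity
      linarith
    · rw [integral_stdNormalCdf_eq_laplaceCdf hs] at h
      have h1 : ∫ t in Ioi 0, gaussMonomial 1 x (s / t) / (2 * (s / t)) * Real.exp (-t)
          = 1 / 2 * ∫ t in Ioi 0, gaussMonomial 1 x (s / t) / (s / t) * Real.exp (-t) := by
        rw [← integral_const_mul]
        congr 1; ext t
        rw [mul_comm 2 (s / t), ← div_div]; ring
      rw [h1, integral_gaussMonomial_one hs] at h
      convert h using 3
      field_simp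
      ring
  · refine ((hasDerivAt_gaussMonomial 1 x hu).div ((hasDerivAt_id u).const_mul 2)
      (by simpa using hu.ne')).congr_deriv ?_
    simp only [id]
    field_simp
  · rw [abs_div, abs_of_pos (a := 2 * u) (by positivity)]
    refine div_le_div₀ (by linarith) ((hb 1 x u (by simp)).1.trans (by linarith)) hu (by linarith)
  · have hu2 : 0 < u ^ 2 := by positivity
    rw [abs_div, abs_of_pos (a := 2 * u ^ 2) (by positivity)]
    refine div_le_div₀ (by linarith) ((hb 1 x u (by simp)).2.trans (by linarith)) hu2 (by linarith)

/-- The second order approximation to the distribution function of the normalized median of a sample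
of fixed size `m`. -/
noncomputable def fixedSizeApprox (p₀ p₁ p₂ : ℝ) (n : ℕ) (x : ℝ) (m : ℕ) : ℝ :=
  stdNormalCdf (x * √((m : ℝ) / n)) + f₁ p₀ p₁ (x * √((m : ℝ) / n)) / √(m : ℝ)
    + f₂ p₀ p₁ p₂ (x * √((m : ℝ) / n)) / m

/-- The factor z|z| in `f₁` is not a monomial in z = x√u. Its sign depends on x alone and can be
pulled out of the average over u; at x = 0 the convention 0/0 = 0 is harmless. -/
theorem div_abs_mul_sq (x : ℝ) : x / |x| * x ^ 2 = x * |x| := by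
  rcases eq_or_ne x 0 with rfl | hx
  · simp
  · have : |x| ≠ 0 := by positivity
    field_simp
    rw [sq_abs]

theorem fixedSizeApprox_eq {p₀ : ℝ} (hp₀ : p₀ ≠ 0) (p₁ p₂ x : ℝ) {n m : ℕ} (hn : 1 ≤ n)
    (hm : 1 ≤ m) :
    fixedSizeApprox p₀ p₁ p₂ n x m = stdNormalCdf (x * √((m : ℝ) / n))
      + (p₁ / (4 * p₀ ^ 2) * (x / |x|) * (√(n : ℝ))⁻¹)
        * (gaussMonomial 2 x ((m : ℝ) / n) / √((m : ℝ) / n))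
      + 3 / 4 * (√(n : ℝ))⁻¹ ^ 2 * (gaussMonomial 1 x ((m : ℝ) / n) / ((m : ℝ) / n))
      + (1 + p₂ / (6 * p₀ ^ 3)) / 4 * (√(n : ℝ))⁻¹ ^ 2
        * (gaussMonomial 3 x ((m : ℝ) / n) / ((m : ℝ) / n))
      - p₁ ^ 2 / (32 * p₀ ^ 4) * (√(n : ℝ))⁻¹ ^ 2
        * (gaussMonomial 5 x ((m : ℝ) / n) / ((m : ℝ) / n)) := by
  have hn' : (0 : ℝ) < n := by exact_mod_cast hn
  have hm' : (0 : ℝ) < m := by exact_mod_cast hm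
  have hsn : 0 < √(n : ℝ) := Real.sqrt_pos.2 hn'
  have hsm : 0 < √(m : ℝ) := Real.sqrt_pos.2 hm'
  have h1 : f₁ p₀ p₁ (x * √((m : ℝ) / n)) / √(m : ℝ)
      = (p₁ / (4 * p₀ ^ 2) * (x / |x|) * (√(n : ℝ))⁻¹)
        * (gaussMonomial 2 x ((m : ℝ) / n) / √((m : ℝ) / n)) := by
    have hu : 0 < √((m : ℝ) / n) := by positivity
    have e : (√(m : ℝ)) = √((m : ℝ) / n) * √(n : ℝ) := by
      rw [← Real.sqrt_mul (by positivity)]; congr 1; field_simp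
    have hx := div_abs_mul_sq x
    simp only [f₁, gaussMonomial, abs_mul, abs_of_pos hu]
    rw [e]
    set v := √((m : ℝ) / n)
    calc _ = p₁ / (4 * p₀ ^ 2) * (x * |x|) * v * stdNormalDensity (x * v) / √(n : ℝ) := by
          field_simp
      _ = _ := by rw [← hx]; field_simp
  have h2 : f₂ p₀ p₁ p₂ (x * √((m : ℝ) / n)) / m
      = 3 / 4 * (√(n : ℝ))⁻¹ ^ 2 * (gaussMonomial 1 x ((m : ℝ) / n) / ((m : ℝ) / n))
      + (1 + p₂ / (6 * p₀ ^ 3)) / 4 * (√(n : ℝ))⁻¹ ^ 2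
        * (gaussMonomial 3 x ((m : ℝ) / n) / ((m : ℝ) / n))
      - p₁ ^ 2 / (32 * p₀ ^ 4) * (√(n : ℝ))⁻¹ ^ 2
        * (gaussMonomial 5 x ((m : ℝ) / n) / ((m : ℝ) / n)) := by
    rw [inv_pow, Real.sq_sqrt hn'.le]
    simp only [f₂, gaussMonomial]
    set z := x * √((m : ℝ) / n)
    field_simp
    ring
  rw [fixedSizeApprox, h1, h2]
  ring

theorem inv_sqrt_natCast_pow {n : ℕ} (hn : 1 ≤ n) :
    (n : ℝ) ^ (-(1 / 2) : ℝ) = (√(n : ℝ))⁻¹ ∧ (n : ℝ) ^ (-1 : ℝ) = (√(n : ℝ))⁻¹ ^ 2 ∧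
      (n : ℝ) ^ (-(3 / 2) : ℝ) = (√(n : ℝ))⁻¹ ^ 3 ∧ ((n : ℝ))⁻¹ = (√(n : ℝ))⁻¹ ^ 2 ∧
      0 < (√(n : ℝ))⁻¹ ∧ (√(n : ℝ))⁻¹ ≤ 1 := by
  have hn1 : (1 : ℝ) ≤ n := by exact_mod_cast hn
  have hn' : (0 : ℝ) < n := by linarith
  have h1 : (√(n : ℝ))⁻¹ = (n : ℝ) ^ (-(1 / 2) : ℝ) := by
    rw [Real.sqrt_eq_rpow, Real.rpow_neg hn'.le]
  have h2 : (√(n : ℝ))⁻¹ ^ 2 = ((n : ℝ))⁻¹ := by rw [inv_pow, Real.sq_sqrt hn'.le]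
  refine ⟨h1.symm, by rw [h2, Real.rpow_neg_one], ?_, h2.symm, by positivity, ?_⟩
  · rw [h1, ← Real.rpow_natCast, ← Real.rpow_mul hn'.le]; norm_num
  · exact inv_le_one_of_one_le₀ (Real.one_le_sqrt.2 hn1)

theorem exists_abs_integral_fixedSizeApprox_sub_le (hs : 0 < s) {p₀ : ℝ} (hp₀ : p₀ ≠ 0)
    (p₁ p₂ : ℝ) :
    ∃ C : ℝ, 0 ≤ C ∧ ∀ (x : ℝ) (n : ℕ), 1 ≤ n →
      IntegrableOn (fun t => fixedSizeApprox p₀ p₁ p₂ n x (paretoCeil s n t)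
        * Real.exp (-t)) (Ioi 0) ∧
      |(∫ t in Ioi 0, fixedSizeApprox p₀ p₁ p₂ n x (paretoCeil s n t) * Real.exp (-t))
        - laplaceExpansion s p₀ p₁ p₂ n x| ≤ C * (n : ℝ) ^ (-(3 / 2) : ℝ) := by
  obtain ⟨C₀, hC₀, H₀⟩ := exists_abs_integral_stdNormalCdf_le hs
  obtain ⟨C₂, hC₂, H₂⟩ := exists_abs_integral_gaussMonomial_div_sqrt_le hs 2
  obtain ⟨C₁, hC₁, H₁⟩ := exists_abs_integral_gaussMonomial_div_le hs 1
  obtain ⟨C₃, hC₃, H₃⟩ := exists_abs_integral_gaussMonomial_div_le hs 3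
  obtain ⟨C₅, hC₅, H₅⟩ := exists_abs_integral_gaussMonomial_div_le hs 5
  set c₂ := p₁ / (4 * p₀ ^ 2) with hc₂
  set c₃ := (1 + p₂ / (6 * p₀ ^ 3)) / 4 with hc₃
  set c₅ := p₁ ^ 2 / (32 * p₀ ^ 4) with hc₅
  refine ⟨C₀ + |c₂| * C₂ + 3 / 4 * C₁ + |c₃| * C₃ + |c₅| * C₅, by positivity, fun x n hn => ?_⟩
  have hn' : (0 : ℝ) < n := by exact_mod_cast hn
  obtain ⟨e1, e2, e3, e4, hr0, hr1⟩ := inv_sqrt_natCast_pow hn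
  set r := (√(n : ℝ))⁻¹ with hr
  obtain ⟨i0, b0⟩ := H₀ x n hn
  obtain ⟨i1, b1⟩ := H₁ x n hn
  obtain ⟨i2, b2⟩ := H₂ x n hn
  obtain ⟨i3, b3⟩ := H₃ x n hn
  obtain ⟨i5, b5⟩ := H₅ x n hn
  rw [integral_gaussMonomial_one hs] at b1
  rw [integral_gaussMonomial_two hs] at b2
  rw [integral_gaussMonomial_three hs] at b3
  rw [integral_gaussMonomial_five hs] at b5
  set σ := x / |x| with hσ
  have hσ1 : |σ| ≤ 1 := by
    rw [hσ, abs_div, abs_abs]; exact div_self_le_one _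
  have j2 := i2.const_mul (c₂ * σ * r)
  have j1 := i1.const_mul (3 / 4 * r ^ 2)
  have j3 := i3.const_mul (c₃ * r ^ 2)
  have j5 := i5.const_mul (c₅ * r ^ 2)
  have k2 := i0.add j2
  have k1 := k2.add j1
  have k3 := k1.add j3
  have k5 := k3.sub j5
  have hG : ∀ t ∈ Ioi (0 : ℝ), fixedSizeApprox p₀ p₁ p₂ n x (paretoCeil s n t) * Real.exp (-t)
      = ((((fun t => stdNormalCdf (x * √((paretoCeil s n t : ℝ) / n)) * Real.exp (-t))
        + (fun t => c₂ * σ * r * (gaussMonomial 2 x ((paretoCeil s n t : ℝ) / n)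
          / √((paretoCeil s n t : ℝ) / n) * Real.exp (-t)))
        + (fun t => 3 / 4 * r ^ 2 * (gaussMonomial 1 x ((paretoCeil s n t : ℝ) / n)
          / ((paretoCeil s n t : ℝ) / n) * Real.exp (-t)))
        + (fun t => c₃ * r ^ 2 * (gaussMonomial 3 x ((paretoCeil s n t : ℝ) / n)
          / ((paretoCeil s n t : ℝ) / n) * Real.exp (-t)))
        - (fun t => c₅ * r ^ 2 * (gaussMonomial 5 x ((paretoCeil s n t : ℝ) / n)
          / ((paretoCeil s n t : ℝ) / n) * Real.exp (-t))) : ℝ → ℝ))) t := by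
    intro t ht
    rw [fixedSizeApprox_eq hp₀ p₁ p₂ x hn (one_le_paretoCeil hs hn ht)]
    simp only [Pi.add_apply, Pi.sub_apply]
    ring
  refine ⟨IntegrableOn.congr_fun k5 (fun t ht => (hG t ht).symm) measurableSet_Ioi, ?_⟩
  rw [setIntegral_congr_fun measurableSet_Ioi hG, integral_sub' k3 j5, integral_add' k1 j3,
    integral_add' k2 j1, integral_add' i0 j2, integral_const_mul, integral_const_mul,
    integral_const_mul, integral_const_mul]
  rw [laplaceExpansion, e1, e2, e3]
  have hdiv : ∀ C : ℝ, C / n = C * r ^ 2 := fun C => by rw [div_eq_mul_inv, e4]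
  have hdiv2 : C₀ / (n : ℝ) ^ 2 = C₀ * r ^ 4 := by
    rw [div_eq_mul_inv, ← inv_pow, e4]; ring
  have hs4 : (1 - s) / (4 * (n : ℝ)) = (1 - s) / 4 * r ^ 2 := by rw [← hdiv]; field_simp
  rw [hdiv] at b1 b2 b3 b5
  rw [hdiv2, hs4] at b0
  set l := laplaceDensity (1 / √s) x
  set q := x * (1 + √(2 * s) * |x|) / (2 * s) with hq
  have hA₁ : A₁ p₀ p₁ x = c₂ * (σ * x ^ 2) := by
    rw [hσ, div_abs_mul_sq, A₁, hc₂]; ring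
  -- The coefficient (4 - s)/4 is 3/4 from the linear term of `f₂` plus (1 - s)/4 from the shift of
  -- the sample size.
  have hA₂ : A₂ s p₀ p₁ p₂ x = (4 - s) / 4 * q + c₃ * x ^ 3
      - c₅ * (x ^ 3 * |x| * √(2 * s)) := by
    rw [A₂, hq, hc₃, hc₅]; field_simp; ring
  rw [hA₁, hA₂]
  set I0 := ∫ t in Ioi 0, stdNormalCdf (x * √((paretoCeil s n t : ℝ) / n)) * Real.exp (-t)
  set I1 := ∫ t in Ioi 0, gaussMonomial 1 x ((paretoCeil s n t : ℝ) / n)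
    / ((paretoCeil s n t : ℝ) / n) * Real.exp (-t)
  set I2 := ∫ t in Ioi 0, gaussMonomial 2 x ((paretoCeil s n t : ℝ) / n)
    / √((paretoCeil s n t : ℝ) / n) * Real.exp (-t)
  set I3 := ∫ t in Ioi 0, gaussMonomial 3 x ((paretoCeil s n t : ℝ) / n)
    / ((paretoCeil s n t : ℝ) / n) * Real.exp (-t)
  set I5 := ∫ t in Ioi 0, gaussMonomial 5 x ((paretoCeil s n t : ℝ) / n)
    / ((paretoCeil s n t : ℝ) / n) * Real.exp (-t)
  have hsplit : I0 + c₂ * σ * r * I2 + 3 / 4 * r ^ 2 * I1 + c₃ * r ^ 2 * I3 - c₅ * r ^ 2 * I5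
      - (laplaceCdf (1 / √s) x + l * (c₂ * (σ * x ^ 2) * r + ((4 - s) / 4 * q + c₃ * x ^ 3
        - c₅ * (x ^ 3 * |x| * √(2 * s))) * r ^ 2))
      = (I0 - laplaceCdf (1 / √s) x - (1 - s) / 4 * r ^ 2 * (l * q))
        + c₂ * σ * r * (I2 - l * x ^ 2) + 3 / 4 * r ^ 2 * (I1 - l * q)
        + c₃ * r ^ 2 * (I3 - l * x ^ 3) - c₅ * r ^ 2 * (I5 - l * (x ^ 3 * |x| * √(2 * s))) := by
    ring
  -- With r = n^(-1/2), only the `f₁` term has an error bound of order r³; all others are of order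
  -- r⁴.
  have hr43 : r ^ 4 ≤ r ^ 3 := pow_le_pow_of_le_one hr0.le hr1 (by norm_num)
  have d0 : |I0 - laplaceCdf (1 / √s) x - (1 - s) / 4 * r ^ 2 * (l * q)| ≤ C₀ * r ^ 3 :=
    b0.trans (by gcongr)
  have d2 : |c₂ * σ * r * (I2 - l * x ^ 2)| ≤ |c₂| * C₂ * r ^ 3 := by
    rw [abs_mul, abs_mul, abs_mul, abs_of_pos hr0]
    calc _ ≤ |c₂| * 1 * r * (C₂ * r ^ 2) := by gcongr
      _ = _ := by ring
  have d1 : |3 / 4 * r ^ 2 * (I1 - l * q)| ≤ 3 / 4 * C₁ * r ^ 3 := by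
    rw [abs_mul, abs_of_pos (by positivity)]
    calc _ ≤ 3 / 4 * r ^ 2 * (C₁ * r ^ 2) := by gcongr
      _ = 3 / 4 * C₁ * r ^ 4 := by ring
      _ ≤ _ := by gcongr
  have d3 : |c₃ * r ^ 2 * (I3 - l * x ^ 3)| ≤ |c₃| * C₃ * r ^ 3 := by
    rw [abs_mul, abs_mul, abs_of_pos (a := r ^ 2) (by positivity)]
    calc _ ≤ |c₃| * r ^ 2 * (C₃ * r ^ 2) := by gcongr
      _ = |c₃| * C₃ * r ^ 4 := by ring
      _ ≤ _ := by gcongr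
  have d5 : |c₅ * r ^ 2 * (I5 - l * (x ^ 3 * |x| * √(2 * s)))| ≤ |c₅| * C₅ * r ^ 3 := by
    rw [abs_mul, abs_mul, abs_of_pos (a := r ^ 2) (by positivity)]
    calc _ ≤ |c₅| * r ^ 2 * (C₅ * r ^ 2) := by gcongr
      _ = |c₅| * C₅ * r ^ 4 := by ring
      _ ≤ _ := by gcongr
  rw [hsplit]
  refine (abs_sub _ _).trans ((add_le_add ((abs_add_le _ _).trans (add_le_add
    ((abs_add_le _ _).trans (add_le_add ((abs_add_le _ _).trans (add_le_add d0 d2)) d1)) d3))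
    d5).trans_eq ?_)
  ring

/-! ### Transfer from fixed to random sample size -/

variable {Ω : Type*} [MeasurableSpace Ω] {P : Measure Ω}

theorem MedianExpansion.abs_fixedSizeCdf_sub_le {p₀ p₁ p₂ C₂ θ : ℝ} {X : ℕ → Ω → ℝ}
    (h : MedianExpansion p₀ p₁ p₂ C₂ θ X P) {n m : ℕ} (hn : 1 ≤ n) (hm : 1 ≤ m) (x : ℝ) :
    |fixedSizeCdf p₀ θ X P n x m - fixedSizeApprox p₀ p₁ p₂ n x m|
      ≤ C₂ / (m : ℝ) ^ (3 / 2 : ℝ) := by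
  have hn' : (0 : ℝ) < n := by exact_mod_cast hn
  have hm' : (0 : ℝ) < m := by exact_mod_cast hm
  have hset : {ω | normalizedMedian p₀ θ X n (fun _ => m) ω ≤ x}
      = {ω | 2 * p₀ * √(evenPart m : ℝ) * (sampleMedian (fun i => X i ω) m - θ)
        ≤ x * √((m : ℝ) / n)} := by
    ext ω
    have hv : 0 < √((n : ℝ) / m) := by positivity
    have h1 : √((n : ℝ) * (evenPart m : ℝ) / (m : ℝ)) = √((n : ℝ) / m) * √(evenPart m : ℝ) := by
      rw [← Real.sqrt_mul (by positivity)]; congr 1; ring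
    have h2 : √((m : ℝ) / n) = (√((n : ℝ) / m))⁻¹ := by
      rw [← Real.sqrt_inv, inv_div]
    simp only [mem_ofPred_eq, normalizedMedian]
    rw [h1, h2, ← div_eq_mul_inv, le_div_iff₀ hv]
    ring_nf
  rw [fixedSizeCdf, hset, fixedSizeApprox]
  have := h m hm (x * √((m : ℝ) / n))
  rwa [sub_sub, sub_sub, ← add_assoc] at this

/-- The lower bound on N/n gives (n/N)^(3/2) ≤ 1 + (κt)², so the mean of N^(-3/2) is O(n^(-3/2)).
The absolute value of `C₂` appears because its sign is not assumed. -/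
theorem exists_abs_integral_fixedSizeCdf_sub_le (hs : 0 < s) (C₂ : ℝ) :
    ∃ C : ℝ, 0 ≤ C ∧ ∀ (F G : ℕ → ℝ) (n : ℕ), 1 ≤ n →
      (∀ m, 1 ≤ m → |F m - G m| ≤ C₂ / (m : ℝ) ^ (3 / 2 : ℝ)) →
      IntegrableOn (fun t => F (paretoCeil s n t) * Real.exp (-t)) (Ioi 0) →
      IntegrableOn (fun t => G (paretoCeil s n t) * Real.exp (-t)) (Ioi 0) →
      |(∫ t in Ioi 0, F (paretoCeil s n t) * Real.exp (-t))
        - ∫ t in Ioi 0, G (paretoCeil s n t) * Real.exp (-t)| ≤ C * (n : ℝ) ^ (-(3 / 2) : ℝ) := by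
  set κ := 1 + 2 / s with hκ
  have hκ0 : 0 < κ := by positivity
  have hB : IntegrableOn (fun t => |C₂| * (Real.exp (-t)
      + κ ^ 2 * (t ^ 2 * Real.exp (-(1 * t))))) (Ioi 0) :=
    (integrableOn_exp_neg.add
      ((integrableOn_pow_mul_exp_neg 2 one_pos).const_mul (κ ^ 2))).const_mul |C₂|
  refine ⟨∫ t in Ioi 0, |C₂| * (Real.exp (-t) + κ ^ 2 * (t ^ 2 * Real.exp (-(1 * t)))),
    setIntegral_nonneg measurableSet_Ioi fun t _ => by positivity, ?_⟩
  intro F G n hn hFG hF hG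
  have hn' : (0 : ℝ) < n := by exact_mod_cast hn
  rw [← integral_sub hF hG, ← integral_mul_const, ← Real.norm_eq_abs]
  refine norm_integral_le_of_norm_le (hB.mul_const _)
    ((ae_restrict_iff' measurableSet_Ioi).2 (Eventually.of_forall fun t ht => ?_))
  have ht : (0 : ℝ) < t := ht
  have hN := one_le_paretoCeil hs hn ht
  have hN' : (0 : ℝ) < paretoCeil s n t := by exact_mod_cast hN
  have h1 := one_div_le_paretoCeil_div hs hn ht
  have hpos : 0 < 1 / (κ * t) := by positivity
  set N : ℝ := (paretoCeil s n t : ℝ)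
  have h2 : n / N ≤ κ * t := by
    have := one_div_le_one_div_of_le hpos h1
    rwa [one_div_one_div, one_div_div] at this
  have h3 : (n / N) ^ (3 / 2 : ℝ) ≤ 1 + (κ * t) ^ 2 := by
    have h0 : 0 ≤ n / N := by positivity
    rcases le_total (n / N) 1 with h | h
    · have : (n / N) ^ (3 / 2 : ℝ) ≤ 1 := Real.rpow_le_one h0 h (by norm_num)
      have : 0 ≤ (κ * t) ^ 2 := by positivity
      linarith
    · have h4 : (n / N) ^ (3 / 2 : ℝ) ≤ (n / N) ^ (2 : ℝ) :=
        Real.rpow_le_rpow_of_exponent_le h (by norm_num)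
      rw [Real.rpow_two] at h4
      have : (n / N) ^ 2 ≤ (κ * t) ^ 2 := by gcongr
      linarith
  have h4 : C₂ / N ^ (3 / 2 : ℝ) ≤ |C₂| * (1 + (κ * t) ^ 2) * (n : ℝ) ^ (-(3 / 2) : ℝ) := by
    have h5 : 1 / N ^ (3 / 2 : ℝ) = (n / N) ^ (3 / 2 : ℝ) * (n : ℝ) ^ (-(3 / 2) : ℝ) := by
      rw [Real.div_rpow hn'.le hN'.le, Real.rpow_neg hn'.le]
      have : (n : ℝ) ^ (3 / 2 : ℝ) ≠ 0 := by positivity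
      field_simp
    rw [div_eq_mul_one_div, h5, ← mul_assoc]
    gcongr
    exact le_abs_self _
  rw [← sub_mul, Real.norm_eq_abs, abs_mul, abs_of_pos (Real.exp_pos _)]
  calc _ ≤ |C₂| * (1 + (κ * t) ^ 2) * (n : ℝ) ^ (-(3 / 2) : ℝ) * Real.exp (-t) := by
        gcongr
        exact (hFG _ hN).trans h4
    _ = _ := by rw [one_mul]; ring

theorem integrableOn_fixedSizeCdf [IsProbabilityMeasure P] (p₀ θ : ℝ) (X : ℕ → Ω → ℝ) (n : ℕ)
    (x : ℝ) :
    IntegrableOn (fun t => fixedSizeCdf p₀ θ X P n x (paretoCeil s n t) * Real.exp (-t))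
      (Ioi 0) := by
  have hm : Measurable fun t => fixedSizeCdf p₀ θ X P n x (paretoCeil s n t) :=
    (measurable_from_nat (f := fixedSizeCdf p₀ θ X P n x)).comp (measurable_paretoCeil s n)
  refine integrableOn_of_abs_le measurableSet_Ioi integrableOn_exp_neg
    (Measurable.aestronglyMeasurable (by fun_prop)) fun t _ => ?_
  rw [abs_mul, abs_of_pos (Real.exp_pos _), fixedSizeCdf,
    abs_of_nonneg measureReal_nonneg]
  exact mul_le_of_le_one_left (Real.exp_pos _).le measureReal_le_one

end Expansion

end RandomMedian

/-! ### Combining the transfer to random sample size with the expansion of the mixture. -/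

theorem theorem5p3
    (s : ℝ) (hs : 0 < s)
    -- the density of the observations, `p₀ = p 0`, `p₁ = p'(0+)`, `p₂ = p''(0+)`
    (p : ℝ → ℝ) (hp_meas : Measurable p) (hp_nonneg : ∀ x, 0 ≤ p x) (hp_zero : 0 < p 0)
    (x₀ : ℝ) (hx₀ : 0 < x₀) (hp_diff : ContDiffOn ℝ 2 p (Ioo 0 x₀))
    (p₁ p₂ : ℝ)
    (hp₁ : Tendsto (deriv p) (𝓝[>] 0) (𝓝 p₁))
    (hp₂ : Tendsto (iteratedDeriv 2 p) (𝓝[>] 0) (𝓝 p₂))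
    (C₂ : ℝ) :
    ∃ C : ℝ, ∀ {Ω : Type*} [MeasurableSpace Ω] (P : Measure Ω) [IsProbabilityMeasure P]
      (θ : ℝ) (X : ℕ → Ω → ℝ) (Y : ℕ → Ω → ℕ),
      IsLocationSample p θ X P →
      IsDiscreteParetoSample s Y P →
      (∀ n : ℕ, 1 ≤ n → IndepFun (fun ω i => X i ω) (sampleSize Y n) P) →
      MedianExpansion (p 0) p₁ p₂ C₂ θ X P →
      ∀ n : ℕ, 1 ≤ n → ∀ x : ℝ,
        |P.real {ω | normalizedMedian (p 0) θ X n (sampleSize Y n) ω ≤ x}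
            - laplaceExpansion s (p 0) p₁ p₂ n x|
          ≤ C * (n : ℝ) ^ (-(3 / 2) : ℝ) := by
  obtain ⟨C, -, hC⟩ := exists_abs_integral_fixedSizeApprox_sub_le hs hp_zero.ne' p₁ p₂
  obtain ⟨C', -, hC'⟩ := exists_abs_integral_fixedSizeCdf_sub_le hs C₂
  -- `C'` bounds the averaged remainder of the fixed-size expansion and `C` the error in averaging
  -- its main terms. Both are fixed before the probability space, θ, n and x.
  refine ⟨C' + C, fun P _ θ X Y hX hY hind hM n hn x => ?_⟩
  rw [real_normalizedMedian_eq_integral (fun i => (hX.law i).aemeasurable)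
    (aemeasurable_sampleSize hY.aemeasurable n) (hind n hn), integral_map_sampleSize hs hY hn]
  obtain ⟨hi, h1⟩ := hC x n hn
  have h2 := hC' _ _ n hn (fun m hm => hM.abs_fixedSizeCdf_sub_le hn hm x)
    (integrableOn_fixedSizeCdf (s := s) (P := P) (p 0) θ X n x) hi
  refine (abs_sub_le _ _ _).trans ((add_le_add h2 h1).trans_eq ?_)
  ring
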